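/- Let $M$ be a smooth manifold of dimension $n$. Let $A^k(M)=\Gamma(\wedge^kTM)$ be the space of smooth $k$-vector fields and $\Omega^l(M)$ the space of smooth $l$-forms (both zero in negative degrees), $\mathcal A(M)=\bigoplus_{k}A^k(M)$, and let $[\cdot,\cdot]$ be the Schouten--Nijenhuis bracket. Forms are evaluated on multivector fields through $(\alpha_1\wedge\cdots\wedge\alpha_l)(v_1\wedge\cdots\wedge v_l)=\det(\alpha_i(v_j))$, with $\eta(f):=f\eta$ for $\eta\in\Omega^0(M)$ and $f\in A^0(M)=C^\infty(M)$. For $X\in A^k(M)$ and $\omega\in\Omega^l(M)$, the interior product $i_X\omega\in\Omega^{l-k}(M)$ is given by $(i_X\omega)(Y)=\omega(X\wedge Y)$ (so $i_X\omega=\omega(X)$ if $k=l$, $i_X\omega=0$ if $k>l$, and $i_f\omega=f\omega$ for a function $f$), and for $k\geq 1$ the Lie derivative is $L_X\omega=d\,i_X\omega-(-1)^k i_X\,d\omega$. A higher affine connection on $M$ is a map $\nabla:\mathcal A(M)\times\mathcal A(M)\to\mathcal A(M)$, $(X,Y)\mapsto\nabla_XY$, such that $\nabla_XY\in A^{k+l-1}(M)$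 for $X\in A^k(M)$, $Y\in A^l(M)$; $\nabla_{fX+X'}Y=f\nabla_XY+\nabla_{X'}Y$ and $\nabla_X(Y+Y')=\nabla_XY+\nabla_XY'$ for $f\in C^\infty(M)$ and $X,X',Y,Y'\in\mathcal A(M)$; $\nabla_Xf=[X,f]$ and $\nabla_X(fY)=[X,f]\wedge Y+f\nabla_XY$ for $X\in A^k(M)$, $f\in C^\infty(M)$, $Y\in\mathcal A(M)$; and $\nabla_fX=0$ for $f\in C^\infty(M)$, $X\in\mathcal A(M)$. It is upper induced if $\nabla_X(Y\wedge Z)=(\nabla_XY)\wedge Z+(-1)^{(k-1)l}\,Y\wedge\nabla_XZ$ for all $X\in A^k(M)$, $Y\in A^l(M)$, $Z\in\mathcal A(M)$. For $X\in A^k(M)$ with $k>0$ and $\omega\in\Omega^l(M)$ with $l-k+1\ge 0$, the covariant derivative $\nabla_X\omega\in\Omega^{l-k+1}(M)$ is the form with $$(\nabla_X\omega)(Y)=(-1)^{(k-1)(l-1)}L_Xi_Y\omega-\omega(\nabla_XY)\qquad\text{for all }Y\in A^{l-k+1}(M),$$ and $\nabla_X\omega:=0$ if $k=0$ or $l-k+1<0$.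 **Theorem.** Let $\nabla$ be a higher affine connection on $M$, let $X\in A^k(M)$ with $k>0$, and let $\omega\in\Omega^l(M)$. If $l-k+1\ge 0$, there is exactly one form $\nabla_X\omega\in\Omega^{l-k+1}(M)$ as above. For every $f\in C^\infty(M)$: (i) $\nabla_{fX}\omega=f\nabla_X\omega$; (ii) $\nabla_X(f\omega)=f\nabla_X\omega+i_{[X,f]}\omega$. If $\nabla$ is moreover upper induced, then for every $j$ and every $W\in A^j(M)$: (iii) $\nabla_X(i_W\omega)=(-1)^{j(k-1)}\left(i_W\nabla_X\omega+i_{\nabla_XW}\omega\right)$. -/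

import Mathlib

open scoped Manifold ContDiff

namespace HigherAffine

noncomputable section

/-! ### Multivector fields and differential forms -/

/-- A (not necessarily smooth) section `x ↦ X x ∈ ⋀ T_x M` of the full exterior bundle of an
`n`-manifold. The exterior product is the pointwise product `X * Y` in the exterior algebras, and a
function `f : M → ℝ` acts by `f • X`. -/
abbrev MultivectorField (n : ℕ) (M : Type*) [TopologicalSpace M]
    [ChartedSpace (EuclideanSpace ℝ (Fin n)) M] : Type _ :=
  (x : M) → ExteriorAlgebra ℝ (TangentSpace (𝓡 n) x)

/-- A (not necessarily smooth, not necessarily homogeneous) differential form, where `⋀^l T_x^* M` is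
identified with the dual of `⋀^l T_x M` through `(α₁ ∧ ⋯ ∧ α_l)(v₁ ∧ ⋯ ∧ v_l) = det (α_i v_j)`:
`θ x` is a linear functional on `⋀ T_x M = ⨁_l ⋀^l T_x M`. The value of `θ` on a multivector field
`Y` at `x` is `θ x (Y x)`; a function `f` is the form that takes the value `f x * g` on
`g ∈ ⋀^0 T_x M = ℝ`. -/
abbrev FormField (n : ℕ) (M : Type*) [TopologicalSpace M]
    [ChartedSpace (EuclideanSpace ℝ (Fin n)) M] : Type _ :=
  (x : M) → (ExteriorAlgebra ℝ (TangentSpace (𝓡 n) x) →ₗ[ℝ] ℝ)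

/-- The exterior power `⋀^k V`, with `⋀^k V = 0` for `k < 0`. -/
def extPow (V : Type*) [AddCommGroup V] [Module ℝ V] : ℤ → Submodule ℝ (ExteriorAlgebra ℝ V)
  | Int.ofNat k => ⋀[ℝ]^k V
  | Int.negSucc _ => ⊥

/-- The basis `e_{i₁} ∧ ⋯ ∧ e_{i_k}`, `i₁ < ⋯ < i_k`, of `⋀ ℝⁿ`. -/
def wedgeBasis (n : ℕ) :
    Module.Basis (Finset (Fin n)) ℝ (ExteriorAlgebra ℝ (EuclideanSpace ℝ (Fin n))) :=
  (EuclideanSpace.basisFun (Fin n) ℝ).toBasis.ExteriorAlgebra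

variable {n : ℕ} {M : Type*} [TopologicalSpace M] [ChartedSpace (EuclideanSpace ℝ (Fin n)) M]

/-- The differential at `x` of the chart `φ` around `x₀`. -/
def chartDiff (x₀ x : M) : TangentSpace (𝓡 n) x →ₗ[ℝ] EuclideanSpace ℝ (Fin n) :=
  (mfderiv (𝓡 n) 𝓘(ℝ, EuclideanSpace ℝ (Fin n)) (extChartAt (𝓡 n) x₀) x).toLinearMap

/-- The differential at `y` of the inverse `φ⁻¹` of the chart `φ` around `x₀`. -/
def chartSymmDiff (x₀ : M) (y : EuclideanSpace ℝ (Fin n)) :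
    EuclideanSpace ℝ (Fin n) →ₗ[ℝ] TangentSpace (𝓡 n) ((extChartAt (𝓡 n) x₀).symm y) :=
  (mfderiv 𝓘(ℝ, EuclideanSpace ℝ (Fin n)) (𝓡 n) (extChartAt (𝓡 n) x₀).symm y).toLinearMap

/-- The representation of a multivector field in the chart `φ` around `x₀`: the push-forward by
`φ`. -/
def MultivectorField.inChart (X : MultivectorField n M) (x₀ : M) (y : EuclideanSpace ℝ (Fin n)) :
    ExteriorAlgebra ℝ (EuclideanSpace ℝ (Fin n)) :=
  ExteriorAlgebra.map (chartDiff x₀ ((extChartAt (𝓡 n) x₀).symm y))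
    (X ((extChartAt (𝓡 n) x₀).symm y))

/-- The representation of a form in the chart `φ` around `x₀`: the pull-back by `φ⁻¹`. -/
def FormField.inChart (θ : FormField n M) (x₀ : M) (y : EuclideanSpace ℝ (Fin n)) :
    ExteriorAlgebra ℝ (EuclideanSpace ℝ (Fin n)) →ₗ[ℝ] ℝ :=
  (θ ((extChartAt (𝓡 n) x₀).symm y)) ∘ₗ (ExteriorAlgebra.map (chartSymmDiff x₀ y)).toLinearMap

/-- `X ∈ 𝒜(M)`: all components of `X` in all charts are smooth. -/
def MultivectorField.IsSmooth (X : MultivectorField n M) : Prop :=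
  ∀ (x₀ : M) (s : Finset (Fin n)),
    ContDiffOn ℝ ∞ (fun y => (wedgeBasis n).repr (X.inChart x₀ y) s) (extChartAt (𝓡 n) x₀).target

/-- All components of `θ` in all charts are smooth. -/
def FormField.IsSmooth (θ : FormField n M) : Prop :=
  ∀ (x₀ : M) (s : Finset (Fin n)),
    ContDiffOn ℝ ∞ (fun y => θ.inChart x₀ y (wedgeBasis n s)) (extChartAt (𝓡 n) x₀).target

/-- `X ∈ A^k(M)`: `X` is a smooth `k`-vector field (and `A^k(M) = 0` for `k < 0`). -/
def MultivectorField.IsKVector (k : ℤ) (X : MultivectorField n M) : Prop :=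
  X.IsSmooth ∧ ∀ x, X x ∈ extPow (TangentSpace (𝓡 n) x) k

/-- `θ ∈ Ω^l(M)`: `θ` is a smooth `l`-form, i.e. it vanishes on the multivectors of all other degrees
(and `Ω^l(M) = 0` for `l < 0`). -/
def FormField.IsForm (l : ℤ) (θ : FormField n M) : Prop :=
  θ.IsSmooth ∧ ∀ (x : M) (m : ℤ), m ≠ l → ∀ v ∈ extPow (TangentSpace (𝓡 n) x) m, θ x v = 0

/-- `f ∈ C^∞(M)`. -/
def IsSmoothFun (n : ℕ) {M : Type*} [TopologicalSpace M]
    [ChartedSpace (EuclideanSpace ℝ (Fin n)) M] (f : M → ℝ) : Prop :=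
  ContMDiff (𝓡 n) 𝓘(ℝ, ℝ) ∞ f

/-- A function regarded as a `0`-vector field. -/
def ofFun (n : ℕ) {M : Type*} [TopologicalSpace M]
    [ChartedSpace (EuclideanSpace ℝ (Fin n)) M] (f : M → ℝ) : MultivectorField n M :=
  fun x => algebraMap ℝ (ExteriorAlgebra ℝ (TangentSpace (𝓡 n) x)) (f x)

/-! ### The Schouten-Nijenhuis bracket -/

/-- The componentwise partial derivative `∂P/∂y^i` of a map `P : ℝⁿ → ⋀ ℝⁿ`. -/
def partialDeriv (i : Fin n)
    (P : EuclideanSpace ℝ (Fin n) → ExteriorAlgebra ℝ (EuclideanSpace ℝ (Fin n)))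
    (y : EuclideanSpace ℝ (Fin n)) : ExteriorAlgebra ℝ (EuclideanSpace ℝ (Fin n)) :=
  ∑ s : Finset (Fin n),
    fderiv ℝ (fun z => (wedgeBasis n).repr (P z) s) y (EuclideanSpace.single i 1) • wedgeBasis n s

/-- The contraction from the right with the coordinate covector `dy^i`:
`v₁ ∧ ⋯ ∧ v_p ↦ ∑_a (-1)^(p-a) (v_a)^i v₁ ∧ ⋯ ∧ v̂_a ∧ ⋯ ∧ v_p`. -/
def contractCoord (i : Fin n) (v : ExteriorAlgebra ℝ (EuclideanSpace ℝ (Fin n))) :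
    ExteriorAlgebra ℝ (EuclideanSpace ℝ (Fin n)) :=
  CliffordAlgebra.contractRight v ((EuclideanSpace.basisFun (Fin n) ℝ).toBasis.coord i)

/-- The Schouten-Nijenhuis bracket `[P, Q]` of a `p`-vector field `P` and a `q`-vector field `Q`, by
its expression
`[P, Q] = ∑_i ((P ⌊ dy^i) ∧ ∂_i Q - (-1)^((p-1)(q-1)) (Q ⌊ dy^i) ∧ ∂_i P)`
in local coordinates (at `x` those of the preferred chart at `x`). This is the bracket with
`[f, g] = 0` for functions, `[X, Q] = L_X Q` for vector fields `X`,
`[P, Q] = -(-1)^((p-1)(q-1)) [Q, P]` and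
`[P, Q ∧ R] = [P, Q] ∧ R + (-1)^((p-1)q) Q ∧ [P, R]`. -/
def schouten (p q : ℤ) (P Q : MultivectorField n M) : MultivectorField n M := fun x =>
  ExteriorAlgebra.map
    ((mfderiv (𝓡 n) 𝓘(ℝ, EuclideanSpace ℝ (Fin n)) (extChartAt (𝓡 n) x) x).inverse.toLinearMap :
      EuclideanSpace ℝ (Fin n) →ₗ[ℝ] TangentSpace (𝓡 n) x)
    (∑ i : Fin n,
      (contractCoord i (P.inChart x (extChartAt (𝓡 n) x x)) *
          partialDeriv i (Q.inChart x) (extChartAt (𝓡 n) x x) -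
        ((-1 : ℝ) ^ ((p - 1) * (q - 1))) •
          (contractCoord i (Q.inChart x (extChartAt (𝓡 n) x x)) *
            partialDeriv i (P.inChart x) (extChartAt (𝓡 n) x x))))

/-! ### Interior product, exterior derivative and Lie derivative of forms -/

/-- The interior product, `(i_X θ)(Y) = θ(X ∧ Y)`. For `X ∈ A^k(M)` and `θ ∈ Ω^l(M)` this is
`θ(X)` if `k = l`, it is `0` if `k > l`, and it is `f θ` if `X` is a function `f`. -/
def interior (X : MultivectorField n M) (θ : FormField n M) : FormField n M :=
  fun x => θ x ∘ₗ LinearMap.mulLeft ℝ (X x)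

/-- A multilinear map on a power of `ℝⁿ` is continuous. -/
theorem continuous_multilinear {l : ℕ}
    (f : MultilinearMap ℝ (fun _ : Fin l => EuclideanSpace ℝ (Fin n)) ℝ) : Continuous f := by
  have h : (f : (Fin l → EuclideanSpace ℝ (Fin n)) → ℝ) = fun v =>
      ∑ r : Fin l → Fin n, (∏ i, v i (r i)) * f (fun i => EuclideanSpace.single (r i) 1) := by
    funext v
    have hv : v = fun i => ∑ j, v i j • EuclideanSpace.single j (1 : ℝ) := by
      funext i
      have := (EuclideanSpace.basisFun (Fin n) ℝ).sum_repr (v i)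
      simpa using this.symm
    conv_lhs => rw [hv]
    rw [f.map_sum]
    refine Finset.sum_congr rfl fun r _ => ?_
    rw [f.map_smul_univ (fun i => v i (r i)) (fun i => EuclideanSpace.single (r i) 1), smul_eq_mul]
  rw [h]
  fun_prop

/-- The degree `l` part of a linear functional on `⋀ ℝⁿ`, as an alternating map. -/
def altPart (l : ℕ) (α : ExteriorAlgebra ℝ (EuclideanSpace ℝ (Fin n)) →ₗ[ℝ] ℝ) :
    EuclideanSpace ℝ (Fin n) [⋀^Fin l]→L[ℝ] ℝ :=
  { α.compAlternatingMap (ExteriorAlgebra.ιMulti ℝ l) with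
    cont := continuous_multilinear
      (α.compAlternatingMap (ExteriorAlgebra.ιMulti ℝ l)).toMultilinearMap }

/-- The linear functional on `⋀ ℝⁿ` whose degree `l + 1` part is the exterior derivative at `y` of
the degree `l` part of `α`. -/
def extDerivFlat
    (α : EuclideanSpace ℝ (Fin n) → (ExteriorAlgebra ℝ (EuclideanSpace ℝ (Fin n)) →ₗ[ℝ] ℝ))
    (y : EuclideanSpace ℝ (Fin n)) : ExteriorAlgebra ℝ (EuclideanSpace ℝ (Fin n)) →ₗ[ℝ] ℝ :=
  ExteriorAlgebra.liftAlternating fun l => match l with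
    | 0 => 0
    | l + 1 => (extDeriv (fun z => altPart l (α z)) y).toAlternatingMap

/-- The exterior derivative of forms on `M`, computed at `x` in the preferred chart at `x`. -/
def extDer (θ : FormField n M) : FormField n M := fun x =>
  extDerivFlat (θ.inChart x) (extChartAt (𝓡 n) x x) ∘ₗ
    (ExteriorAlgebra.map (chartDiff x x)).toLinearMap

/-- The Lie derivative `L_X θ = d i_X θ - (-1)^k i_X dθ` along `X ∈ A^k(M)`. -/
def lieDer (k : ℤ) (X : MultivectorField n M) (θ : FormField n M) : FormField n M :=
  extDer (interior X θ) - ((-1 : ℝ) ^ k) • interior X (extDer θ)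

/-! ### Higher affine connections -/

/-- A higher affine connection on `M`, i.e. a map `∇ : 𝒜(M) × 𝒜(M) → 𝒜(M)`; `D X Y` is `∇_X Y`.
Its values on sections that are not smooth are irrelevant. -/
structure HigherConnection (n : ℕ) (M : Type*) [TopologicalSpace M]
    [ChartedSpace (EuclideanSpace ℝ (Fin n)) M] where
  D : MultivectorField n M → MultivectorField n M → MultivectorField n M
  smooth : ∀ X Y : MultivectorField n M, X.IsSmooth → Y.IsSmooth → (D X Y).IsSmooth
  degree : ∀ (k l : ℤ) (X Y : MultivectorField n M), X.IsKVector k → Y.IsKVector l →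
    (D X Y).IsKVector (k + l - 1)
  linear_left : ∀ (f : M → ℝ) (X X' Y : MultivectorField n M), IsSmoothFun n f →
    X.IsSmooth → X'.IsSmooth → Y.IsSmooth → D (f • X + X') Y = f • D X Y + D X' Y
  add_right : ∀ X Y Y' : MultivectorField n M, X.IsSmooth → Y.IsSmooth → Y'.IsSmooth →
    D X (Y + Y') = D X Y + D X Y'
  apply_fun : ∀ (k : ℤ) (X : MultivectorField n M) (f : M → ℝ), X.IsKVector k →
    IsSmoothFun n f → D X (ofFun n f) = schouten k 0 X (ofFun n f)
  leibniz : ∀ (k : ℤ) (X Y : MultivectorField n M) (f : M → ℝ), X.IsKVector k →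
    IsSmoothFun n f → Y.IsSmooth → D X (f • Y) = schouten k 0 X (ofFun n f) * Y + f • D X Y
  fun_left : ∀ (f : M → ℝ) (X : MultivectorField n M), IsSmoothFun n f → X.IsSmooth →
    D (ofFun n f) X = 0

namespace HigherConnection

/-- `∇` is upper induced: `∇_X (Y ∧ Z) = (∇_X Y) ∧ Z + (-1)^((k-1)l) Y ∧ ∇_X Z` for `X ∈ A^k(M)`,
`Y ∈ A^l(M)`, `Z ∈ 𝒜(M)`. -/
def IsUpperInduced (C : HigherConnection n M) : Prop :=
  ∀ (k l : ℤ) (X Y Z : MultivectorField n M), X.IsKVector k → Y.IsKVector l → Z.IsSmooth →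
    C.D X (Y * Z) = C.D X Y * Z + ((-1 : ℝ) ^ ((k - 1) * l)) • (Y * C.D X Z)

/-- `η` is the covariant derivative of `θ ∈ Ω^l(M)` along `X ∈ A^k(M)`: it is an `(l-k+1)`-form, and
`η(Y) = (-1)^((k-1)(l-1)) L_X i_Y θ - θ(∇_X Y)` for all `Y ∈ A^(l-k+1)(M)`. Here `L_X i_Y θ` is a
`0`-form; the function that it stands for is its value on `1 ∈ ⋀^0 T_x M`. -/
def IsCovDer (C : HigherConnection n M) (k l : ℤ) (X : MultivectorField n M)
    (θ η : FormField n M) : Prop :=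
  η.IsForm (l - k + 1) ∧
    ∀ Y : MultivectorField n M, Y.IsKVector (l - k + 1) → ∀ x : M,
      η x (Y x) =
        ((-1 : ℝ) ^ ((k - 1) * (l - 1))) * lieDer k X (interior Y θ) x 1 - θ x (C.D X Y x)

open Classical in
/-- The covariant derivative `∇_X θ` of `θ ∈ Ω^l(M)` along `X ∈ A^k(M)`: the form that `IsCovDer`
describes if `k > 0` and `l - k + 1 ≥ 0`, and `0` otherwise. -/
def covDer (C : HigherConnection n M) (k l : ℤ) (X : MultivectorField n M)
    (θ : FormField n M) : FormField n M :=
  if h : 0 < k ∧ 0 ≤ l - k + 1 ∧ ∃ η : FormField n M, C.IsCovDer k l X θ η then h.2.2.choose else 0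

end HigherConnection

end

end HigherAffine

/-!
Evaluated at `1`, the function `L_X i_Y θ` is `-(-1)^k (d i_Y θ)(X)`. By the Leibniz rule for `d`,
replacing `Y` by `f Y` adds to `(d i_Y θ)(X)`, besides the factor `f`, the term
`θ(Y ∧ (df ⌋ X)) = ± θ((X ⌊ df) ∧ Y)`. Since `[X, f] = X ⌊ df`, this cancels the term
`θ([X, f] ∧ Y)` of `θ(∇_X (f Y))`, so the prescribed value of `∇_X θ` on `Y` is `C^∞(M)`-linear
in `Y`. Such a map comes from a unique form, as one sees on coordinate frames that are cut off by
bump functions. By this uniqueness, each of the identities (i)-(iii) only has to be checked on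
multivector fields.
-/

namespace HigherAffine

open Filter Topology
open CliffordAlgebra (contractLeft contractRight)

/-! ### Contractions in the exterior algebra -/

section ExteriorAlgebra

open ExteriorAlgebra (ι ιMulti)

variable {R V V' : Type*} [CommRing R] [AddCommGroup V] [Module R V] [AddCommGroup V'] [Module R V']

instance finite_exteriorAlgebra [Module.Free R V] [Module.Finite R V] :
    Module.Finite R (ExteriorAlgebra R V) := by
  nontriviality R
  exact .of_basis (Module.finBasis R V).ExteriorAlgebra

theorem map_mem_exteriorPower (f : V →ₗ[R] V') {p : ℕ} {a : ExteriorAlgebra R V}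
    (ha : a ∈ ⋀[R]^p V) : ExteriorAlgebra.map f a ∈ ⋀[R]^p V' := by
  rw [← ExteriorAlgebra.ιMulti_span_fixedDegree] at ha ⊢
  refine Submodule.span_le (p := (Submodule.span R _).comap (ExteriorAlgebra.map f).toLinearMap)
    |>.2 ?_ ha
  rintro _ ⟨v, rfl⟩
  exact Submodule.subset_span ⟨f ∘ v, (ExteriorAlgebra.map_apply_ιMulti f v).symm⟩

theorem contractLeft_ιMulti_succ (d : Module.Dual R V) {l : ℕ} (v : Fin (l + 1) → V) :
    contractLeft d (ιMulti R (l + 1) v) =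
      ∑ i : Fin (l + 1), ((-1) ^ (i : ℕ) * d (v i)) • ιMulti R l (i.removeNth v) := by
  induction l with
  | zero =>
    rw [ExteriorAlgebra.ιMulti_succ_apply, CliffordAlgebra.contractLeft_ι_mul]
    simp
  | succ l ih =>
    have tail_removeNth (i : Fin (l + 1)) :
        ιMulti R (l + 1) (i.succ.removeNth v) =
          ι R (v 0) * ιMulti R l (i.removeNth (Matrix.vecTail v)) := by
      rw [ExteriorAlgebra.ιMulti_succ_apply]
      congr
      funext j
      simp [Matrix.vecTail, Fin.removeNth]
    rw [ExteriorAlgebra.ιMulti_succ_apply, CliffordAlgebra.contractLeft_ι_mul, ih,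
      Fin.sum_univ_succ (n := l + 1), Finset.mul_sum, sub_eq_add_neg, ← Finset.sum_neg_distrib]
    simp only [tail_removeNth, mul_smul_comm, ← neg_smul, Fin.val_zero, pow_zero, one_mul,
      Fin.val_succ, pow_succ, mul_neg_one, neg_mul]
    rfl

theorem contractLeft_mem_exteriorPower (d : Module.Dual R V) {p : ℕ} {a : ExteriorAlgebra R V}
    (ha : a ∈ ⋀[R]^(p + 1) V) : contractLeft d a ∈ ⋀[R]^p V := by
  rw [← ExteriorAlgebra.ιMulti_span_fixedDegree] at ha ⊢
  refine Submodule.span_le (p := (Submodule.span R _).comap (contractLeft d)) |>.2 ?_ ha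
  rintro _ ⟨v, rfl⟩
  rw [SetLike.mem_coe, Submodule.mem_comap, contractLeft_ιMulti_succ]
  exact Submodule.sum_mem _ fun i _ => Submodule.smul_mem _ _ (Submodule.subset_span ⟨_, rfl⟩)

theorem map_contractLeft (f : V →ₗ[R] V') (d : Module.Dual R V') (a : ExteriorAlgebra R V) :
    ExteriorAlgebra.map f (contractLeft (d ∘ₗ f) a) = contractLeft d (ExteriorAlgebra.map f a) := by
  induction a using CliffordAlgebra.left_induction with
  | algebraMap r => simp
  | add a b ha hb => simp only [map_add, ha, hb]
  | ι_mul a v ih =>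
    rw [CliffordAlgebra.contractLeft_ι_mul, map_sub, map_smul, map_mul, map_mul, ih,
      ExteriorAlgebra.map_apply_ι, CliffordAlgebra.contractLeft_ι_mul, LinearMap.comp_apply]

theorem map_contractRight (f : V →ₗ[R] V') (d : Module.Dual R V') (a : ExteriorAlgebra R V) :
    ExteriorAlgebra.map f (contractRight a (d ∘ₗ f)) =
      contractRight (ExteriorAlgebra.map f a) d := by
  induction a using CliffordAlgebra.right_induction with
  | algebraMap r => simp
  | add a b ha hb => simp only [map_add, LinearMap.add_apply, ha, hb]
  | mul_ι v a ih =>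
    rw [CliffordAlgebra.contractRight_mul_ι, map_sub, map_smul, map_mul, map_mul, ih,
      ExteriorAlgebra.map_apply_ι, CliffordAlgebra.contractRight_mul_ι, LinearMap.comp_apply]

theorem ι_mul_of_mem_exteriorPower {q : ℕ} (v : V) {b : ExteriorAlgebra R V} (hb : b ∈ ⋀[R]^q V) :
    ι R v * b = (-1 : R) ^ q • (b * ι R v) := by
  induction hb using Submodule.pow_induction_on_left' with
  | algebraMap r => simp [Algebra.commutes]
  | add x y i hx hy ihx ihy => rw [mul_add, ihx, ihy, add_mul, smul_add]
  | mem_mul m hm i x _ ih =>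
    obtain ⟨w, rfl⟩ := hm
    rw [← mul_assoc, eq_neg_of_add_eq_zero_left (ExteriorAlgebra.ι_add_mul_swap v w), neg_mul,
      mul_assoc, ih, mul_smul_comm, ← mul_assoc, pow_succ, mul_neg_one, neg_smul]

theorem mul_comm_of_mem_exteriorPower {p q : ℕ} {a b : ExteriorAlgebra R V}
    (ha : a ∈ ⋀[R]^p V) (hb : b ∈ ⋀[R]^q V) : a * b = (-1 : R) ^ (p * q) • (b * a) := by
  induction ha using Submodule.pow_induction_on_left' with
  | algebraMap r => simp [Algebra.commutes]
  | add x y i hx hy ihx ihy => rw [add_mul, ihx, ihy, mul_add, smul_add]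
  | mem_mul m hm i x _ ih =>
    obtain ⟨v, rfl⟩ := hm
    rw [mul_assoc, ih, mul_smul_comm, ← mul_assoc, ι_mul_of_mem_exteriorPower v hb, smul_mul_assoc,
      smul_smul, ← pow_add, mul_assoc, Nat.succ_mul]

theorem contractLeft_mul {p : ℕ} (d : Module.Dual R V) {a : ExteriorAlgebra R V}
    (ha : a ∈ ⋀[R]^p V) (b : ExteriorAlgebra R V) :
    contractLeft d (a * b) = contractLeft d a * b + (-1 : R) ^ p • (a * contractLeft d b) := by
  induction ha using Submodule.pow_induction_on_left' with
  | algebraMap r => simp [CliffordAlgebra.contractLeft_algebraMap_mul]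
  | add x y i hx hy ihx ihy =>
    rw [add_mul, map_add, ihx, ihy, map_add, add_mul, add_mul, smul_add]; abel
  | mem_mul m hm i x _ ih =>
    obtain ⟨v, rfl⟩ := hm
    rw [mul_assoc, CliffordAlgebra.contractLeft_ι_mul, CliffordAlgebra.contractLeft_ι_mul, ih,
      sub_mul, mul_add, smul_mul_assoc, mul_smul_comm, pow_succ, mul_neg_one, neg_smul, mul_assoc,
      mul_assoc, sub_add_eq_sub_sub, sub_eq_add_neg]

theorem contractRight_eq_smul_contractLeft (d : Module.Dual R V) {p : ℕ} {a : ExteriorAlgebra R V}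
    (ha : a ∈ ⋀[R]^p V) : contractRight a d = (-1 : R) ^ (p + 1) • contractLeft d a := by
  induction ha using Submodule.pow_induction_on_right' with
  | algebraMap r => simp
  | add x y i hx hy ihx ihy => rw [map_add, LinearMap.add_apply, ihx, ihy, map_add, smul_add]
  | mul_mem i x hx ih m hm =>
    obtain ⟨v, rfl⟩ := hm
    have sign_sq : (-1 : R) ^ (i + 2) * (-1) ^ i = 1 := by
      rw [← pow_add, show i + 2 + i = 2 * (i + 1) by ring, pow_mul, neg_one_sq, one_pow]
    rw [contractLeft_mul d hx, CliffordAlgebra.contractRight_mul_ι,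
      CliffordAlgebra.contractLeft_ι, ih, smul_add, smul_smul, sign_sq, one_smul,
      ← Algebra.commutes, ← Algebra.smul_def, smul_mul_assoc, pow_succ _ (i + 1), mul_neg_one,
      neg_smul, sub_eq_add_neg, add_comm]

end ExteriorAlgebra

section ExtPow

variable {V V' : Type*} [AddCommGroup V] [Module ℝ V] [AddCommGroup V'] [Module ℝ V']
  {p q : ℤ} {a b : ExteriorAlgebra ℝ V}

theorem eq_zero_of_mem_extPow_of_neg (hp : p < 0) (ha : a ∈ extPow V p) : a = 0 := by
  obtain ⟨m, rfl⟩ := Int.eq_negSucc_of_lt_zero hp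
  exact (Submodule.mem_bot ℝ).1 ha

theorem eq_zero_or_exists_mem_exteriorPower (ha : a ∈ extPow V p) :
    a = 0 ∨ ∃ m : ℕ, p = m ∧ a ∈ ⋀[ℝ]^m V := by
  rcases lt_or_ge p 0 with hp | hp
  · exact .inl (eq_zero_of_mem_extPow_of_neg hp ha)
  · lift p to ℕ using hp
    exact .inr ⟨p, rfl, ha⟩

theorem one_mem_extPow_zero : (1 : ExteriorAlgebra ℝ V) ∈ extPow V 0 :=
  SetLike.GradedOne.one_mem (A := fun i : ℕ => ⋀[ℝ]^i V)

theorem mul_mem_extPow (ha : a ∈ extPow V p) (hb : b ∈ extPow V q) : a * b ∈ extPow V (p + q) := by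
  obtain rfl | ⟨p, rfl, -⟩ := eq_zero_or_exists_mem_exteriorPower ha
  · simp
  obtain rfl | ⟨q, rfl, -⟩ := eq_zero_or_exists_mem_exteriorPower hb
  · simp
  exact SetLike.GradedMul.mul_mem (A := fun i : ℕ => ⋀[ℝ]^i V) ha hb

theorem map_mem_extPow (f : V →ₗ[ℝ] V') (ha : a ∈ extPow V p) :
    ExteriorAlgebra.map f a ∈ extPow V' p := by
  obtain rfl | ⟨p, rfl, -⟩ := eq_zero_or_exists_mem_exteriorPower ha
  · simp
  exact map_mem_exteriorPower f ha

theorem mul_contractLeft_of_mem_extPow (d : Module.Dual ℝ V) (ha : a ∈ extPow V p)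
    (hb : b ∈ extPow V q) :
    b * contractLeft d a = (-1 : ℝ) ^ ((p - 1) * (q + 1)) • (contractRight a d * b) := by
  obtain rfl | ⟨p, rfl, ha'⟩ := eq_zero_or_exists_mem_exteriorPower ha
  · simp
  obtain rfl | ⟨q, rfl, hb'⟩ := eq_zero_or_exists_mem_exteriorPower hb
  · simp
  cases p with
  | zero =>
    obtain ⟨r, rfl⟩ : ∃ r, algebraMap ℝ (ExteriorAlgebra ℝ V) r = a := by
      simpa [ExteriorAlgebra.exteriorPower, Submodule.mem_one] using ha'
    simp
  | succ p =>
    have sign : (-1 : ℝ) ^ (((p + 1 : ℕ) - 1) * (q + 1) : ℤ) * (-1) ^ (p + 1 + 1) =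
        (-1) ^ (q * p) := by
      rw [show ((p + 1 : ℕ) - 1) * (q + 1 : ℤ) = (p * (q + 1) : ℕ) by push_cast; ring,
        zpow_natCast, ← pow_add, show p * (q + 1) + (p + 1 + 1) = q * p + 2 * (p + 1) by ring,
        pow_add, pow_mul _ 2, neg_one_sq, one_pow, mul_one]
    rw [mul_comm_of_mem_exteriorPower hb' (contractLeft_mem_exteriorPower d ha'),
      contractRight_eq_smul_contractLeft d ha', smul_mul_assoc, smul_smul, sign]

end ExtPow

section WedgeBasis

variable {n : ℕ}

theorem wedgeBasis_mem_extPow (s : Finset (Fin n)) :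
    wedgeBasis n s ∈ extPow (EuclideanSpace ℝ (Fin n)) s.card := by
  change _ ∈ ⋀[ℝ]^s.card (EuclideanSpace ℝ (Fin n))
  rw [wedgeBasis, ExteriorAlgebra.basis_apply, ← ExteriorAlgebra.ιMulti_span_fixedDegree]
  exact Submodule.subset_span ⟨_, rfl⟩

theorem wedgeBasis_repr_eq_zero {m : ℤ} {a : ExteriorAlgebra ℝ (EuclideanSpace ℝ (Fin n))}
    (ha : a ∈ extPow (EuclideanSpace ℝ (Fin n)) m) {s : Finset (Fin n)} (hs : (s.card : ℤ) ≠ m) :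
    (wedgeBasis n).repr a s = 0 := by
  obtain rfl | ⟨m, rfl, -⟩ := eq_zero_or_exists_mem_exteriorPower ha
  · simp
  rw [wedgeBasis, Module.Basis.ExteriorAlgebra, Module.Basis.repr_reindex_apply]
  exact DirectSum.IsInternal.collectedBasis_repr_of_mem_ne _ _ (mod_cast hs.symm) ha

end WedgeBasis

/-! ### Smooth families in finite-dimensional vector spaces -/

section WeaklySmoothAt

variable {E H N : Type*} [NormedAddCommGroup E] [NormedSpace ℝ E] [TopologicalSpace H]
  {I : ModelWithCorners ℝ E H} [TopologicalSpace N] [ChartedSpace H N]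
  {V W : Type*} [AddCommGroup V] [Module ℝ V] [AddCommGroup W] [Module ℝ W]

/-- A map `P` from a manifold to a real vector space `V` is weakly smooth at `x` if `φ ∘ P` is
smooth at `x` for all linear forms `φ` on `V`. For finite-dimensional `V`, this is smoothness with
respect to the canonical topology, which Mathlib does not put on exterior algebras. -/
def WeaklySmoothAt (I : ModelWithCorners ℝ E H) (P : N → V) (x : N) : Prop :=
  ∀ φ : Module.Dual ℝ V, ContMDiffAt I 𝓘(ℝ, ℝ) ∞ (fun z => φ (P z)) x

theorem weaklySmoothAt_const (v : V) (x : N) : WeaklySmoothAt I (fun _ => v) x := fun _ =>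
  contMDiffAt_const

theorem weaklySmoothAt_sum {ι : Type*} {s : Finset ι} {P : ι → N → V} {x : N}
    (hP : ∀ i ∈ s, WeaklySmoothAt I (P i) x) : WeaklySmoothAt I (fun z => ∑ i ∈ s, P i z) x := by
  intro φ
  simp only [map_sum]
  exact contMDiffAt_finsetSum fun i hi => hP i hi φ

namespace WeaklySmoothAt

variable {P Q : N → V} {f : N → ℝ} {x : N}

theorem congr_of_eventuallyEq (hP : WeaklySmoothAt I P x) (h : Q =ᶠ[𝓝 x] P) :
    WeaklySmoothAt I Q x := fun φ =>
  (hP φ).congr_of_eventuallyEq (h.fun_comp φ)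

theorem add (hP : WeaklySmoothAt I P x) (hQ : WeaklySmoothAt I Q x) :
    WeaklySmoothAt I (fun z => P z + Q z) x := by
  intro φ
  simp only [map_add]
  exact (hP φ).add (hQ φ)

theorem smul (hf : ContMDiffAt I 𝓘(ℝ, ℝ) ∞ f x) (hP : WeaklySmoothAt I P x) :
    WeaklySmoothAt I (fun z => f z • P z) x := by
  intro φ
  simp only [map_smul]
  exact hf.smul (hP φ)

theorem linear (hP : WeaklySmoothAt I P x) (T : V →ₗ[ℝ] W) :
    WeaklySmoothAt I (fun z => T (P z)) x := fun φ =>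
  hP (φ ∘ₗ T)

theorem comp {E' H' N' : Type*} [NormedAddCommGroup E'] [NormedSpace ℝ E'] [TopologicalSpace H']
    {I' : ModelWithCorners ℝ E' H'} [TopologicalSpace N'] [ChartedSpace H' N'] {g : N' → N} {y : N'}
    (hP : WeaklySmoothAt I P (g y)) (hg : ContMDiffAt I' I ∞ g y) :
    WeaklySmoothAt I' (fun z => P (g z)) y := fun φ =>
  ContMDiffAt.comp (g := fun z => φ (P z)) y (hP φ) hg

end WeaklySmoothAt

variable {P : N → V} {x : N}

theorem weaklySmoothAt_iff_repr {ι : Type*} [Finite ι] (b : Module.Basis ι ℝ V) :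
    WeaklySmoothAt I P x ↔ ∀ i, ContMDiffAt I 𝓘(ℝ, ℝ) ∞ (fun z => b.repr (P z) i) x := by
  refine ⟨fun hP i => hP (b.coord i), fun hP => ?_⟩
  have := Fintype.ofFinite ι
  rw [show P = fun z => ∑ i, b.repr (P z) i • b i from funext fun z => (b.sum_repr (P z)).symm]
  exact weaklySmoothAt_sum fun i _ => .smul (hP i) (weaklySmoothAt_const (b i) x)

theorem weaklySmoothAt_dual_iff_basis {ι : Type*} [Finite ι] (b : Module.Basis ι ℝ V)
    {α : N → Module.Dual ℝ V} :
    WeaklySmoothAt I α x ↔ ∀ i, ContMDiffAt I 𝓘(ℝ, ℝ) ∞ (fun z => α z (b i)) x := by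
  classical
  simp only [weaklySmoothAt_iff_repr b.dualBasis, Module.Basis.dualBasis_repr]

variable [Module.Finite ℝ V]

theorem WeaklySmoothAt.contMDiffAt_linear {F : Type*} [NormedAddCommGroup F] [NormedSpace ℝ F]
    (hP : WeaklySmoothAt I P x) (T : V →ₗ[ℝ] F) :
    ContMDiffAt I 𝓘(ℝ, F) ∞ (fun z => T (P z)) x := by
  let b := Module.finBasis ℝ V
  have hb (z : N) : T (P z) = ∑ i, b.repr (P z) i • T (b i) := by
    conv_lhs => rw [← b.sum_repr (P z), map_sum]
    simp only [map_smul]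
  simp only [hb]
  exact contMDiffAt_finsetSum fun i _ => (hP (b.coord i)).smul contMDiffAt_const

theorem weaklySmoothAt_iff_contMDiffAt {F : Type*} [NormedAddCommGroup F] [NormedSpace ℝ F]
    [FiniteDimensional ℝ F] {f : N → F} :
    WeaklySmoothAt I f x ↔ ContMDiffAt I 𝓘(ℝ, F) ∞ f x :=
  ⟨fun hf => hf.contMDiffAt_linear LinearMap.id,
    fun hf φ => φ.toContinuousLinearMap.contMDiff.contMDiffAt.comp x hf⟩

theorem weaklySmoothAt_dual_iff {α : N → Module.Dual ℝ V} :
    WeaklySmoothAt I α x ↔ ∀ v, ContMDiffAt I 𝓘(ℝ, ℝ) ∞ (fun z => α z v) x := by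
  refine ⟨fun hα v => hα (Module.Dual.eval ℝ V v), fun hα φ => ?_⟩
  obtain ⟨v, rfl⟩ := (Module.evalEquiv ℝ V).surjective φ
  exact hα v

namespace WeaklySmoothAt

theorem apply {T : N → V →ₗ[ℝ] W} (hT : ∀ v, WeaklySmoothAt I (fun z => T z v) x)
    (hP : WeaklySmoothAt I P x) : WeaklySmoothAt I (fun z => T z (P z)) x := by
  let b := Module.finBasis ℝ V
  have hb : (fun z => T z (P z)) = fun z => ∑ i, b.repr (P z) i • T z (b i) := by
    funext z
    conv_lhs => rw [← b.sum_repr (P z), map_sum]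
    simp only [map_smul]
  rw [hb]
  exact weaklySmoothAt_sum fun i _ => smul (hP (b.coord i)) (hT (b i))

theorem dual_apply {α : N → Module.Dual ℝ V} (hα : WeaklySmoothAt I α x)
    (hP : WeaklySmoothAt I P x) : ContMDiffAt I 𝓘(ℝ, ℝ) ∞ (fun z => α z (P z)) x :=
  weaklySmoothAt_iff_contMDiffAt.1 <|
    apply (fun v => weaklySmoothAt_iff_contMDiffAt.2 (weaklySmoothAt_dual_iff.1 hα v)) hP

theorem mul {A : Type*} [Ring A] [Algebra ℝ A] [Module.Finite ℝ A] {P Q : N → A}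
    (hP : WeaklySmoothAt I P x) (hQ : WeaklySmoothAt I Q x) :
    WeaklySmoothAt I (fun z => P z * Q z) x :=
  apply (T := fun z => LinearMap.mulLeft ℝ (P z)) (fun a => hP.linear (LinearMap.mulRight ℝ a)) hQ

theorem exteriorAlgebra_map [Module.Finite ℝ W] {T : N → V →ₗ[ℝ] W}
    {P : N → ExteriorAlgebra ℝ V} (hT : ∀ v, WeaklySmoothAt I (fun z => T z v) x)
    (hP : WeaklySmoothAt I P x) :
    WeaklySmoothAt I (fun z => ExteriorAlgebra.map (T z) (P z)) x := by
  refine apply (T := fun z => (ExteriorAlgebra.map (T z)).toLinearMap) (fun a => ?_) hP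
  simp only [AlgHom.toLinearMap_apply]
  induction a using ExteriorAlgebra.induction with
  | algebraMap r =>
    simp only [AlgHom.commutes]
    exact weaklySmoothAt_const _ x
  | ι v =>
    simp only [ExteriorAlgebra.map_apply_ι]
    exact (hT v).linear (ExteriorAlgebra.ι ℝ)
  | mul a b ha hb =>
    simp only [map_mul]
    exact ha.mul hb
  | add a b ha hb =>
    simp only [map_add]
    exact ha.add hb

end WeaklySmoothAt

end WeaklySmoothAt

/-! ### The exterior derivative on `ℝⁿ` -/

section ExtDerivFlat

variable {n : ℕ} {y : EuclideanSpace ℝ (Fin n)}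
  {α β : EuclideanSpace ℝ (Fin n) → Module.Dual ℝ (ExteriorAlgebra ℝ (EuclideanSpace ℝ (Fin n)))}

theorem differentiableAt_dual_apply {E V : Type*} [NormedAddCommGroup E] [NormedSpace ℝ E]
    [AddCommGroup V] [Module ℝ V] {α : E → Module.Dual ℝ V} {y : E}
    (hα : WeaklySmoothAt 𝓘(ℝ, E) α y) (v : V) : DifferentiableAt ℝ (fun z => α z v) y :=
  (hα (Module.Dual.eval ℝ V v)).contDiffAt.differentiableAt (by simp)

theorem fderiv_dual_apply {E V ι : Type*} [NormedAddCommGroup E] [NormedSpace ℝ E]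
    [AddCommGroup V] [Module ℝ V] [Fintype ι] (b : Module.Basis ι ℝ V) {α : E → Module.Dual ℝ V}
    {y : E} (hα : WeaklySmoothAt 𝓘(ℝ, E) α y) (v : V) :
    fderiv ℝ (fun z => α z v) y = ∑ i, b.repr v i • fderiv ℝ (fun z => α z (b i)) y := by
  have hv (z : E) : α z v = ∑ i, b.repr v i * α z (b i) := by
    conv_lhs => rw [← b.sum_repr v, map_sum]
    simp only [map_smul, smul_eq_mul]
  simp only [hv]
  rw [fderiv_fun_sum fun i _ => (differentiableAt_dual_apply hα (b i)).const_mul _]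
  exact Finset.sum_congr rfl fun i _ => fderiv_const_mul (differentiableAt_dual_apply hα (b i)) _

theorem altPart_apply (l : ℕ) (φ : Module.Dual ℝ (ExteriorAlgebra ℝ (EuclideanSpace ℝ (Fin n))))
    (v : Fin l → EuclideanSpace ℝ (Fin n)) : altPart l φ v = φ (ExteriorAlgebra.ιMulti ℝ l v) := rfl

theorem WeaklySmoothAt.altPart (hα : WeaklySmoothAt (𝓡 n) α y) (l : ℕ) :
    ContDiffAt ℝ ∞ (fun z => altPart l (α z)) y :=
  (hα.contMDiffAt_linear (F := EuclideanSpace ℝ (Fin n) [⋀^Fin l]→L[ℝ] ℝ)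
    { toFun := HigherAffine.altPart l
      map_add' := fun _ _ => rfl
      map_smul' := fun _ _ => rfl }).contDiffAt

theorem extDerivFlat_apply (hα : WeaklySmoothAt (𝓡 n) α y)
    (v : ExteriorAlgebra ℝ (EuclideanSpace ℝ (Fin n))) :
    extDerivFlat α y v = ∑ s, (wedgeBasis n).coord s
      (contractLeft (fderiv ℝ (fun z => α z (wedgeBasis n s)) y).toLinearMap v) := by
  suffices h : extDerivFlat α y = ∑ s, (wedgeBasis n).coord s ∘ₗ
      contractLeft (fderiv ℝ (fun z => α z (wedgeBasis n s)) y).toLinearMap by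
    simp only [h, LinearMap.sum_apply, LinearMap.comp_apply]
  refine ExteriorAlgebra.lhom_ext fun l => AlternatingMap.ext fun v => ?_
  simp only [LinearMap.compAlternatingMap_apply, extDerivFlat,
    ExteriorAlgebra.liftAlternating_apply_ιMulti]
  cases l with
  | zero => simp [LinearMap.sum_apply]
  | succ l =>
    change extDeriv (fun z => altPart l (α z)) y v = _
    rw [extDeriv_apply ((hα.altPart l).differentiableAt (by simp))]
    simp only [altPart_apply, LinearMap.sum_apply,
      LinearMap.comp_apply, contractLeft_ιMulti_succ, map_sum, map_smul]
    rw [Finset.sum_comm]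
    refine Finset.sum_congr rfl fun i _ => ?_
    rw [fderiv_dual_apply (wedgeBasis n) hα]
    simp only [_root_.sum_apply, _root_.smul_apply, Finset.smul_sum]
    refine Finset.sum_congr rfl fun s _ => ?_
    simp only [zsmul_eq_mul, smul_eq_mul, Int.cast_pow, Int.cast_neg, Int.cast_one,
      ContinuousLinearMap.coe_coe, Module.Basis.coord_apply]
    ring

theorem extDerivFlat_smul {f : EuclideanSpace ℝ (Fin n) → ℝ} (hf : ContDiffAt ℝ ∞ f y)
    (hα : WeaklySmoothAt (𝓡 n) α y) (v : ExteriorAlgebra ℝ (EuclideanSpace ℝ (Fin n))) :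
    extDerivFlat (fun z => f z • α z) y v =
      f y * extDerivFlat α y v + α y (contractLeft (fderiv ℝ f y).toLinearMap v) := by
  rw [extDerivFlat_apply (.smul hf.contMDiffAt hα), extDerivFlat_apply hα,
    ← (wedgeBasis n).sum_dual_apply_smul_coord (α y), LinearMap.sum_apply, Finset.mul_sum,
    ← Finset.sum_add_distrib]
  refine Finset.sum_congr rfl fun s _ => ?_
  have product_rule : fderiv ℝ (fun z => (f z • α z) (wedgeBasis n s)) y =
      f y • fderiv ℝ (fun z => α z (wedgeBasis n s)) y + α y (wedgeBasis n s) • fderiv ℝ f y :=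
    fderiv_fun_mul (hf.differentiableAt (by simp)) (differentiableAt_dual_apply hα _)
  rw [product_rule]
  simp

theorem extDerivFlat_add (hα : WeaklySmoothAt (𝓡 n) α y) (hβ : WeaklySmoothAt (𝓡 n) β y)
    (v : ExteriorAlgebra ℝ (EuclideanSpace ℝ (Fin n))) :
    extDerivFlat (fun z => α z + β z) y v = extDerivFlat α y v + extDerivFlat β y v := by
  rw [extDerivFlat_apply (hα.add hβ), extDerivFlat_apply hα, extDerivFlat_apply hβ,
    ← Finset.sum_add_distrib]
  refine Finset.sum_congr rfl fun s _ => ?_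
  simp only [LinearMap.add_apply]
  rw [fderiv_fun_add (differentiableAt_dual_apply hα _) (differentiableAt_dual_apply hβ _)]
  simp

theorem extDerivFlat_congr (h : α =ᶠ[𝓝 y] β) : extDerivFlat α y = extDerivFlat β y := by
  refine ExteriorAlgebra.lhom_ext fun l => AlternatingMap.ext fun v => ?_
  simp only [LinearMap.compAlternatingMap_apply, extDerivFlat,
    ExteriorAlgebra.liftAlternating_apply_ιMulti]
  cases l with
  | zero => rfl
  | succ l => exact congrArg (· v) (h.fun_comp (altPart l)).extDeriv_eq

theorem extDerivFlat_pullback {τ : EuclideanSpace ℝ (Fin n) → EuclideanSpace ℝ (Fin n)}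
    (hα : WeaklySmoothAt (𝓡 n) α (τ y)) (hτ : ContDiffAt ℝ ∞ τ y) :
    extDerivFlat
        (fun z => α (τ z) ∘ₗ (ExteriorAlgebra.map (fderiv ℝ τ z).toLinearMap).toLinearMap) y =
      extDerivFlat α (τ y) ∘ₗ
        (ExteriorAlgebra.map (fderiv ℝ τ y).toLinearMap).toLinearMap := by
  refine ExteriorAlgebra.lhom_ext fun l => AlternatingMap.ext fun v => ?_
  simp only [LinearMap.compAlternatingMap_apply, extDerivFlat, LinearMap.comp_apply,
    AlgHom.toLinearMap_apply, ExteriorAlgebra.map_apply_ιMulti,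
    ExteriorAlgebra.liftAlternating_apply_ιMulti]
  cases l with
  | zero => rfl
  | succ l =>
    have altPart_pullback : (fun z => altPart l (α (τ z) ∘ₗ
        (ExteriorAlgebra.map (fderiv ℝ τ z).toLinearMap).toLinearMap)) =
        fun z => (altPart l (α (τ z))).compContinuousLinearMap (fderiv ℝ τ z) := by
      funext z
      ext w
      exact congrArg (α (τ z)) (ExteriorAlgebra.map_apply_ιMulti _ w)
    change extDeriv _ y v = extDeriv _ (τ y) _
    rw [altPart_pullback, extDeriv_pullback (r := ∞)
      ((hα.altPart l).differentiableAt (by simp)) hτ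
      (by rw [minSmoothness_of_isRCLikeNormedField]; exact WithTop.coe_le_coe.2 le_top)]
    rfl

theorem WeaklySmoothAt.extDerivFlat (hα : ∀ᶠ z in 𝓝 y, WeaklySmoothAt (𝓡 n) α z) :
    WeaklySmoothAt (𝓡 n) (extDerivFlat α) y := by
  refine weaklySmoothAt_dual_iff.2 fun v => ?_
  have h : (fun z => HigherAffine.extDerivFlat α z v) =ᶠ[𝓝 y] fun z => ∑ s, (wedgeBasis n).coord s
      (contractLeft (fderiv ℝ (fun z => α z (wedgeBasis n s)) z).toLinearMap v) := by
    filter_upwards [hα] with z hz using extDerivFlat_apply hz v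
  refine ContMDiffAt.congr_of_eventuallyEq (contMDiffAt_finsetSum fun s _ => ?_) h
  have hs : ContDiffAt ℝ ∞ (fderiv ℝ fun z => α z (wedgeBasis n s)) y :=
    ((hα.self_of_nhds (Module.Dual.eval ℝ _ (wedgeBasis n s))).contDiffAt).fderiv_right (by simp)
  exact (weaklySmoothAt_iff_contMDiffAt.2 hs.contMDiffAt)
    ((wedgeBasis n).coord s ∘ₗ contractLeft.flip v ∘ₗ ContinuousLinearMap.coeLM ℝ)

end ExtDerivFlat

/-! ### Charts -/

section Charts

variable {n : ℕ} {M : Type*} [TopologicalSpace M] [ChartedSpace (EuclideanSpace ℝ (Fin n)) M]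

/-- The inverse of the differential at `x` of the chart around `x₀`. -/
noncomputable def chartInv (x₀ x : M) : EuclideanSpace ℝ (Fin n) →ₗ[ℝ] TangentSpace (𝓡 n) x :=
  (mfderiv (𝓡 n) 𝓘(ℝ, EuclideanSpace ℝ (Fin n)) (extChartAt (𝓡 n) x₀) x).inverse.toLinearMap

/-- The representation of a multivector field in the chart around `x₀`, as a function on the
manifold instead of the model space. -/
noncomputable def MultivectorField.localRep (X : MultivectorField n M) (x₀ x : M) :
    ExteriorAlgebra ℝ (EuclideanSpace ℝ (Fin n)) :=
  ExteriorAlgebra.map (chartDiff x₀ x) (X x)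

/-- The representation of a form in the chart around `x₀`, as a function on the manifold instead of
the model space. -/
noncomputable def FormField.localRep (θ : FormField n M) (x₀ x : M) :
    Module.Dual ℝ (ExteriorAlgebra ℝ (EuclideanSpace ℝ (Fin n))) :=
  θ x ∘ₗ (ExteriorAlgebra.map (chartInv x₀ x)).toLinearMap

/-- The change of coordinates from the chart around `x₀` to the chart around `x₁`. -/
noncomputable def coordChange (x₀ x₁ : M) (y : EuclideanSpace ℝ (Fin n)) :
    EuclideanSpace ℝ (Fin n) :=
  extChartAt (𝓡 n) x₁ ((extChartAt (𝓡 n) x₀).symm y)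

theorem coordChange_extChartAt {x₀ x₁ x : M} (h₀ : x ∈ (extChartAt (𝓡 n) x₀).source) :
    coordChange x₀ x₁ (extChartAt (𝓡 n) x₀ x) = extChartAt (𝓡 n) x₁ x := by
  rw [coordChange, (extChartAt (𝓡 n) x₀).left_inv h₀]

theorem eventually_extChartAt_symm {x₀ x : M} (hx : x ∈ (extChartAt (𝓡 n) x₀).source)
    {p : M → Prop} (hp : ∀ᶠ z in 𝓝 x, p z) :
    ∀ᶠ y in 𝓝 (extChartAt (𝓡 n) x₀ x), p ((extChartAt (𝓡 n) x₀).symm y) := by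
  refine (continuousAt_extChartAt_symm'' ((extChartAt (𝓡 n) x₀).map_source hx)).eventually ?_
  rwa [(extChartAt (𝓡 n) x₀).left_inv hx]

theorem eventually_mem_extChartAt_target {x₀ x : M} (hx : x ∈ (extChartAt (𝓡 n) x₀).source) :
    ∀ᶠ y in 𝓝 (extChartAt (𝓡 n) x₀ x), y ∈ (extChartAt (𝓡 n) x₀).target :=
  extChartAt_target_mem_nhds' ((extChartAt (𝓡 n) x₀).map_source hx)

theorem eventually_mem_extChartAt_source {x₀ x : M} (hx : x ∈ (extChartAt (𝓡 n) x₀).source) :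
    ∀ᶠ z in 𝓝 x, z ∈ (extChartAt (𝓡 n) x₀).source :=
  extChartAt_source_mem_nhds' hx

variable [IsManifold (𝓡 n) ∞ M]

theorem contMDiffAt_extChartAt_of_mem_source {x₀ x : M} (hx : x ∈ (extChartAt (𝓡 n) x₀).source) :
    ContMDiffAt (𝓡 n) 𝓘(ℝ, EuclideanSpace ℝ (Fin n)) ∞ (extChartAt (𝓡 n) x₀) x :=
  contMDiffAt_extChartAt' (by simpa using hx)

theorem contMDiffAt_extChartAt_symm_of_mem_target {x₀ : M} {y : EuclideanSpace ℝ (Fin n)}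
    (hy : y ∈ (extChartAt (𝓡 n) x₀).target) :
    ContMDiffAt 𝓘(ℝ, EuclideanSpace ℝ (Fin n)) (𝓡 n) ∞ (extChartAt (𝓡 n) x₀).symm y :=
  (contMDiffOn_extChartAt_symm x₀).contMDiffAt (extChartAt_target_mem_nhds' hy)

theorem contDiffOn_comp_extChartAt_symm_iff {f : M → ℝ} {x₀ : M} :
    ContDiffOn ℝ ∞ (fun y => f ((extChartAt (𝓡 n) x₀).symm y)) (extChartAt (𝓡 n) x₀).target ↔
      ∀ x ∈ (extChartAt (𝓡 n) x₀).source, ContMDiffAt (𝓡 n) 𝓘(ℝ, ℝ) ∞ f x := by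
  refine ⟨fun h x hx => ?_, fun h y hy => ?_⟩
  · have hf := (h.contDiffAt (eventually_mem_extChartAt_target hx)).contMDiffAt.comp x
      (contMDiffAt_extChartAt_of_mem_source hx)
    refine hf.congr_of_eventuallyEq ?_
    filter_upwards [eventually_mem_extChartAt_source hx] with z hz
    exact congrArg f ((extChartAt (𝓡 n) x₀).left_inv hz).symm
  · exact ((h _ ((extChartAt (𝓡 n) x₀).map_target hy)).comp y
      (contMDiffAt_extChartAt_symm_of_mem_target hy)).contDiffAt.contDiffWithinAt

theorem isInvertible_mfderiv_extChartAt_of_mem_source {x₀ x : M}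
    (hx : x ∈ (extChartAt (𝓡 n) x₀).source) :
    (mfderiv (𝓡 n) 𝓘(ℝ, EuclideanSpace ℝ (Fin n)) (extChartAt (𝓡 n) x₀) x).IsInvertible := by
  have : IsManifold (𝓡 n) 1 M := IsManifold.of_le (n := ∞) (by simp)
  exact isInvertible_mfderiv_extChartAt hx

theorem map_chartDiff_map_chartInv {x₀ x : M} (hx : x ∈ (extChartAt (𝓡 n) x₀).source)
    (v : ExteriorAlgebra ℝ (EuclideanSpace ℝ (Fin n))) :
    ExteriorAlgebra.map (chartDiff x₀ x) (ExteriorAlgebra.map (chartInv x₀ x) v) = v := by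
  have h : chartDiff x₀ x ∘ₗ chartInv x₀ x = LinearMap.id :=
    congrArg ContinuousLinearMap.toLinearMap
      (isInvertible_mfderiv_extChartAt_of_mem_source hx).self_comp_inverse
  rw [← AlgHom.comp_apply, ExteriorAlgebra.map_comp_map, h, ExteriorAlgebra.map_id, AlgHom.id_apply]

theorem map_chartInv_map_chartDiff {x₀ x : M} (hx : x ∈ (extChartAt (𝓡 n) x₀).source)
    (v : ExteriorAlgebra ℝ (TangentSpace (𝓡 n) x)) :
    ExteriorAlgebra.map (chartInv x₀ x) (ExteriorAlgebra.map (chartDiff x₀ x) v) = v := by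
  have h : chartInv x₀ x ∘ₗ chartDiff x₀ x = LinearMap.id :=
    congrArg ContinuousLinearMap.toLinearMap
      (isInvertible_mfderiv_extChartAt_of_mem_source hx).inverse_comp_self
  rw [← AlgHom.comp_apply, ExteriorAlgebra.map_comp_map, h, ExteriorAlgebra.map_id, AlgHom.id_apply]

theorem FormField.localRep_map_chartDiff (θ : FormField n M) {x₀ x : M}
    (hx : x ∈ (extChartAt (𝓡 n) x₀).source) (v : ExteriorAlgebra ℝ (TangentSpace (𝓡 n) x)) :
    θ.localRep x₀ x (ExteriorAlgebra.map (chartDiff x₀ x) v) = θ x v :=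
  congrArg (θ x) (map_chartInv_map_chartDiff hx v)

theorem chartSymmDiff_eq_chartInv {x₀ : M} {y : EuclideanSpace ℝ (Fin n)}
    (hy : y ∈ (extChartAt (𝓡 n) x₀).target) :
    chartSymmDiff x₀ y = chartInv x₀ ((extChartAt (𝓡 n) x₀).symm y) := by
  have : IsManifold (𝓡 n) 1 M := IsManifold.of_le (n := ∞) (by simp)
  have left := mfderivWithin_extChartAt_symm_comp_mfderiv_extChartAt (I := 𝓡 n) hy
  have right := mfderiv_extChartAt_comp_mfderivWithin_extChartAt_symm (I := 𝓡 n) hy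
  rw [ModelWithCorners.range_eq_univ, mfderivWithin_univ] at left right
  exact congrArg ContinuousLinearMap.toLinearMap (ContinuousLinearMap.inverse_eq right left).symm

theorem FormField.inChart_eq_localRep (θ : FormField n M) {x₀ : M} {y : EuclideanSpace ℝ (Fin n)}
    (hy : y ∈ (extChartAt (𝓡 n) x₀).target) :
    θ.inChart x₀ y = θ.localRep x₀ ((extChartAt (𝓡 n) x₀).symm y) := by
  rw [FormField.inChart, chartSymmDiff_eq_chartInv hy]
  rfl

theorem FormField.inChart_extChartAt (θ : FormField n M) {x₀ x : M}
    (hx : x ∈ (extChartAt (𝓡 n) x₀).source) :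
    θ.inChart x₀ (extChartAt (𝓡 n) x₀ x) = θ.localRep x₀ x := by
  rw [θ.inChart_eq_localRep ((extChartAt (𝓡 n) x₀).map_source hx),
    (extChartAt (𝓡 n) x₀).left_inv hx]

theorem MultivectorField.isSmooth_iff {X : MultivectorField n M} :
    X.IsSmooth ↔ ∀ x₀, ∀ x ∈ (extChartAt (𝓡 n) x₀).source,
      WeaklySmoothAt (𝓡 n) (X.localRep x₀) x := by
  simp only [weaklySmoothAt_iff_repr (wedgeBasis n)]
  refine forall_congr' fun x₀ => ⟨fun h x hx s => ?_, fun h s => ?_⟩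
  · exact contDiffOn_comp_extChartAt_symm_iff.1 (h s) x hx
  · exact contDiffOn_comp_extChartAt_symm_iff.2 fun x hx => h x hx s

theorem FormField.isSmooth_iff {θ : FormField n M} :
    θ.IsSmooth ↔ ∀ x₀, ∀ x ∈ (extChartAt (𝓡 n) x₀).source,
      WeaklySmoothAt (𝓡 n) (θ.localRep x₀) x := by
  have inChart_congr (x₀ : M) (s : Finset (Fin n)) : Set.EqOn (θ.inChart x₀ · (wedgeBasis n s))
      (fun y => θ.localRep x₀ ((extChartAt (𝓡 n) x₀).symm y) (wedgeBasis n s))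
      (extChartAt (𝓡 n) x₀).target := fun y hy =>
        congrArg (· (wedgeBasis n s)) (θ.inChart_eq_localRep hy)
  simp only [weaklySmoothAt_dual_iff_basis (wedgeBasis n)]
  refine forall_congr' fun x₀ => ⟨fun h x hx s => ?_, fun h s => ?_⟩
  · exact contDiffOn_comp_extChartAt_symm_iff.1
      ((contDiffOn_congr (inChart_congr x₀ s)).1 (h s)) x hx
  · exact (contDiffOn_congr (inChart_congr x₀ s)).2 <|
      contDiffOn_comp_extChartAt_symm_iff.2 fun x hx => h x hx s

theorem weaklySmoothAt_comp_extChartAt_symm {V : Type*} [AddCommGroup V] [Module ℝ V] {P : M → V}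
    {x₀ x : M} (hx : x ∈ (extChartAt (𝓡 n) x₀).source) (hP : WeaklySmoothAt (𝓡 n) P x) :
    WeaklySmoothAt (𝓡 n) (fun y => P ((extChartAt (𝓡 n) x₀).symm y)) (extChartAt (𝓡 n) x₀ x) := by
  have hx' := (extChartAt (𝓡 n) x₀).map_source hx
  refine .comp ?_ (contMDiffAt_extChartAt_symm_of_mem_target hx')
  rwa [(extChartAt (𝓡 n) x₀).left_inv hx]

theorem FormField.IsSmooth.weaklySmoothAt_inChart {θ : FormField n M} (hθ : θ.IsSmooth) {x₀ x : M}
    (hx : x ∈ (extChartAt (𝓡 n) x₀).source) :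
    WeaklySmoothAt (𝓡 n) (θ.inChart x₀) (extChartAt (𝓡 n) x₀ x) := by
  refine (weaklySmoothAt_comp_extChartAt_symm hx
    (FormField.isSmooth_iff.1 hθ x₀ x hx)).congr_of_eventuallyEq ?_
  filter_upwards [eventually_mem_extChartAt_target hx] with y hy using θ.inChart_eq_localRep hy

theorem contDiffAt_coordChange {x₀ x₁ x : M} (h₀ : x ∈ (extChartAt (𝓡 n) x₀).source)
    (h₁ : x ∈ (extChartAt (𝓡 n) x₁).source) :
    ContDiffAt ℝ ∞ (coordChange x₀ x₁) (extChartAt (𝓡 n) x₀ x) := by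
  have hx := (extChartAt (𝓡 n) x₀).left_inv h₀
  exact (ContMDiffAt.comp _ (by rw [hx]; exact contMDiffAt_extChartAt_of_mem_source h₁)
    (contMDiffAt_extChartAt_symm_of_mem_target ((extChartAt (𝓡 n) x₀).map_source h₀))).contDiffAt

theorem fderiv_coordChange_comp {x₀ x₁ x : M} (h₀ : x ∈ (extChartAt (𝓡 n) x₀).source)
    (h₁ : x ∈ (extChartAt (𝓡 n) x₁).source) :
    (fderiv ℝ (coordChange x₀ x₁) (extChartAt (𝓡 n) x₀ x)).toLinearMap ∘ₗ chartDiff x₀ x =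
      chartDiff x₁ x := by
  have h : extChartAt (𝓡 n) x₁ =ᶠ[𝓝 x] coordChange x₀ x₁ ∘ extChartAt (𝓡 n) x₀ := by
    filter_upwards [eventually_mem_extChartAt_source h₀] with z hz
    exact (coordChange_extChartAt hz).symm
  rw [chartDiff, chartDiff, h.mfderiv_eq, mfderiv_comp x
    ((contDiffAt_coordChange h₀ h₁).differentiableAt (by simp)).mdifferentiableAt
    ((contMDiffAt_extChartAt_of_mem_source h₀).mdifferentiableAt (by simp)), mfderiv_eq_fderiv]
  rfl

theorem map_fderiv_coordChange {x₀ x₁ x : M} (h₀ : x ∈ (extChartAt (𝓡 n) x₀).source)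
    (h₁ : x ∈ (extChartAt (𝓡 n) x₁).source) (v : ExteriorAlgebra ℝ (TangentSpace (𝓡 n) x)) :
    ExteriorAlgebra.map (fderiv ℝ (coordChange x₀ x₁) (extChartAt (𝓡 n) x₀ x)).toLinearMap
      (ExteriorAlgebra.map (chartDiff x₀ x) v) = ExteriorAlgebra.map (chartDiff x₁ x) v := by
  rw [← fderiv_coordChange_comp h₀ h₁, ← ExteriorAlgebra.map_comp_map, AlgHom.comp_apply]

theorem FormField.localRep_coordChange (θ : FormField n M) {x₀ x₁ x : M}
    (h₀ : x ∈ (extChartAt (𝓡 n) x₀).source) (h₁ : x ∈ (extChartAt (𝓡 n) x₁).source) :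
    θ.localRep x₀ x = θ.localRep x₁ x ∘ₗ (ExteriorAlgebra.map
      (fderiv ℝ (coordChange x₀ x₁) (extChartAt (𝓡 n) x₀ x)).toLinearMap).toLinearMap := by
  refine LinearMap.ext fun v => ?_
  rw [← map_chartDiff_map_chartInv h₀ v, θ.localRep_map_chartDiff h₀, LinearMap.comp_apply,
    AlgHom.toLinearMap_apply, map_fderiv_coordChange h₀ h₁, θ.localRep_map_chartDiff h₁]

theorem weaklySmoothAt_fderiv_coordChange {x₀ x₁ x : M} (h₀ : x ∈ (extChartAt (𝓡 n) x₀).source)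
    (h₁ : x ∈ (extChartAt (𝓡 n) x₁).source) (v : EuclideanSpace ℝ (Fin n)) :
    WeaklySmoothAt (𝓡 n)
      (fun z => (fderiv ℝ (coordChange x₀ x₁) (extChartAt (𝓡 n) x₀ z)).toLinearMap v) x :=
  weaklySmoothAt_iff_contMDiffAt.2 <|
    (((contDiffAt_coordChange h₀ h₁).fderiv_right (by simp)).clm_apply
      contDiffAt_const).contMDiffAt.comp x (contMDiffAt_extChartAt_of_mem_source h₀)

theorem MultivectorField.isSmooth_of_weaklySmoothAt {X : MultivectorField n M}
    (h : ∀ x, ∃ x₀, x ∈ (extChartAt (𝓡 n) x₀).source ∧ WeaklySmoothAt (𝓡 n) (X.localRep x₀) x) :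
    X.IsSmooth := by
  refine MultivectorField.isSmooth_iff.2 fun x₁ x h₁ => ?_
  obtain ⟨x₀, h₀, hX⟩ := h x
  refine (hX.exteriorAlgebra_map
    (weaklySmoothAt_fderiv_coordChange h₀ h₁)).congr_of_eventuallyEq ?_
  filter_upwards [eventually_mem_extChartAt_source h₀, eventually_mem_extChartAt_source h₁]
    with z hz₀ hz₁ using (map_fderiv_coordChange hz₀ hz₁ (X z)).symm

theorem FormField.isSmooth_of_weaklySmoothAt {θ : FormField n M}
    (h : ∀ x, ∃ x₀, x ∈ (extChartAt (𝓡 n) x₀).source ∧ WeaklySmoothAt (𝓡 n) (θ.localRep x₀) x) :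
    θ.IsSmooth := by
  refine FormField.isSmooth_iff.2 fun x₁ x h₁ => weaklySmoothAt_dual_iff.2 fun v => ?_
  obtain ⟨x₀, h₀, hθ⟩ := h x
  refine (hθ.dual_apply ((weaklySmoothAt_const v x).exteriorAlgebra_map
    (weaklySmoothAt_fderiv_coordChange h₁ h₀))).congr_of_eventuallyEq ?_
  filter_upwards [eventually_mem_extChartAt_source h₀, eventually_mem_extChartAt_source h₁]
    with z hz₀ hz₁ using congrArg (· v) (θ.localRep_coordChange hz₁ hz₀)

end Charts

/-! ### Operations on smooth fields and forms -/

section Operations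

variable {n : ℕ} {M : Type*} [TopologicalSpace M] [ChartedSpace (EuclideanSpace ℝ (Fin n)) M]

/-- The differential of a function on `M`. -/
noncomputable def differential (n : ℕ) {M : Type*} [TopologicalSpace M]
    [ChartedSpace (EuclideanSpace ℝ (Fin n)) M] (f : M → ℝ) (x : M) :
    Module.Dual ℝ (TangentSpace (𝓡 n) x) :=
  (mfderiv (𝓡 n) 𝓘(ℝ, ℝ) f x).toLinearMap

theorem extDer_apply_one (θ : FormField n M) (x : M) : extDer θ x 1 = 0 := by
  rw [extDer, LinearMap.comp_apply, AlgHom.toLinearMap_apply, map_one, extDerivFlat,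
    ExteriorAlgebra.liftAlternating_one]
  rfl

theorem partialDeriv_algebraMap (i : Fin n) {g : EuclideanSpace ℝ (Fin n) → ℝ}
    {y : EuclideanSpace ℝ (Fin n)} (hg : DifferentiableAt ℝ g y) :
    partialDeriv i (fun z => algebraMap ℝ _ (g z)) y =
      algebraMap ℝ _ (fderiv ℝ g y (EuclideanSpace.single i 1)) := by
  have hs (s : Finset (Fin n)) (z : EuclideanSpace ℝ (Fin n)) :
      (wedgeBasis n).repr (algebraMap ℝ _ (g z)) s = g z * (wedgeBasis n).repr 1 s := by
    rw [Algebra.algebraMap_eq_smul_one, map_smul, Finsupp.smul_apply, smul_eq_mul]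
  simp only [partialDeriv, hs, fderiv_mul_const hg]
  conv_rhs => rw [Algebra.algebraMap_eq_smul_one, ← (wedgeBasis n).sum_repr 1, Finset.smul_sum]
  simp [smul_smul, mul_comm]

variable [IsManifold (𝓡 n) ∞ M]

namespace MultivectorField

variable {X Y : MultivectorField n M} {f : M → ℝ}

theorem isSmooth_zero : (0 : MultivectorField n M).IsSmooth :=
  isSmooth_iff.2 fun x₀ x _ => by
    have h : (0 : MultivectorField n M).localRep x₀ = fun _ => 0 := funext fun _ => map_zero _
    rw [h]
    exact weaklySmoothAt_const 0 x

theorem IsSmooth.add (hX : X.IsSmooth) (hY : Y.IsSmooth) : (X + Y).IsSmooth :=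
  isSmooth_iff.2 fun x₀ x hx => by
    have h : (X + Y).localRep x₀ = fun z => X.localRep x₀ z + Y.localRep x₀ z :=
      funext fun _ => map_add _ _ _
    rw [h]
    exact (isSmooth_iff.1 hX x₀ x hx).add (isSmooth_iff.1 hY x₀ x hx)

theorem IsSmooth.smul (hf : IsSmoothFun n f) (hX : X.IsSmooth) : (f • X).IsSmooth :=
  isSmooth_iff.2 fun x₀ x hx => by
    have h : (f • X).localRep x₀ = fun z => f z • X.localRep x₀ z :=
      funext fun z => map_smul _ (f z) (X z)
    rw [h]
    exact .smul (hf x) (isSmooth_iff.1 hX x₀ x hx)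

theorem IsSmooth.mul (hX : X.IsSmooth) (hY : Y.IsSmooth) : (X * Y).IsSmooth :=
  isSmooth_iff.2 fun x₀ x hx => by
    have h : (X * Y).localRep x₀ = fun z => X.localRep x₀ z * Y.localRep x₀ z :=
      funext fun _ => map_mul _ _ _
    rw [h]
    exact (isSmooth_iff.1 hX x₀ x hx).mul (isSmooth_iff.1 hY x₀ x hx)

end MultivectorField

namespace FormField

variable {θ η : FormField n M} {X : MultivectorField n M} {f : M → ℝ}

theorem IsSmooth.add (hθ : θ.IsSmooth) (hη : η.IsSmooth) : (θ + η).IsSmooth :=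
  isSmooth_iff.2 fun x₀ x hx => (isSmooth_iff.1 hθ x₀ x hx).add (isSmooth_iff.1 hη x₀ x hx)

theorem IsSmooth.smul (hf : IsSmoothFun n f) (hθ : θ.IsSmooth) : (f • θ).IsSmooth :=
  isSmooth_iff.2 fun x₀ x hx => .smul (hf x) (isSmooth_iff.1 hθ x₀ x hx)

theorem localRep_apply_localRep (θ : FormField n M) (X : MultivectorField n M) {x₀ x : M}
    (hx : x ∈ (extChartAt (𝓡 n) x₀).source) : θ.localRep x₀ x (X.localRep x₀ x) = θ x (X x) :=
  θ.localRep_map_chartDiff hx (X x)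

theorem IsSmooth.isSmoothFun_apply (hθ : θ.IsSmooth) (hX : X.IsSmooth) :
    IsSmoothFun n fun x => θ x (X x) := fun x => by
  have hx := mem_extChartAt_source (I := 𝓡 n) x
  refine ((isSmooth_iff.1 hθ x x hx).dual_apply
    (MultivectorField.isSmooth_iff.1 hX x x hx)).congr_of_eventuallyEq ?_
  filter_upwards [eventually_mem_extChartAt_source hx]
    with z hz using (θ.localRep_apply_localRep X hz).symm

theorem localRep_interior (θ : FormField n M) (X : MultivectorField n M) {x₀ x : M}
    (hx : x ∈ (extChartAt (𝓡 n) x₀).source) (v : ExteriorAlgebra ℝ (EuclideanSpace ℝ (Fin n))) :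
    (interior X θ).localRep x₀ x v = θ.localRep x₀ x (X.localRep x₀ x * v) := by
  rw [← map_chartDiff_map_chartInv hx v, localRep_map_chartDiff _ hx, MultivectorField.localRep,
    ← map_mul, localRep_map_chartDiff _ hx]
  rfl

theorem IsSmooth.interior (hX : X.IsSmooth) (hθ : θ.IsSmooth) :
    (HigherAffine.interior X θ).IsSmooth := by
  refine isSmooth_iff.2 fun x₀ x hx => weaklySmoothAt_dual_iff.2 fun v => ?_
  refine ((isSmooth_iff.1 hθ x₀ x hx).dual_apply ((MultivectorField.isSmooth_iff.1 hX x₀ x hx).mul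
    (weaklySmoothAt_const v x))).congr_of_eventuallyEq ?_
  filter_upwards [eventually_mem_extChartAt_source hx] with z hz using θ.localRep_interior X hz v

end FormField

/-! ### The exterior derivative -/

theorem extDer_apply {θ : FormField n M} (hθ : θ.IsSmooth) {x₀ x : M}
    (h₀ : x ∈ (extChartAt (𝓡 n) x₀).source) (v : ExteriorAlgebra ℝ (TangentSpace (𝓡 n) x)) :
    extDer θ x v = extDerivFlat (θ.inChart x₀) (extChartAt (𝓡 n) x₀ x)
      (ExteriorAlgebra.map (chartDiff x₀ x) v) := by
  have hx := mem_extChartAt_source (I := 𝓡 n) x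
  have inChart_eq_pullback : θ.inChart x =ᶠ[𝓝 (extChartAt (𝓡 n) x x)] fun y =>
      θ.inChart x₀ (coordChange x x₀ y) ∘ₗ (ExteriorAlgebra.map
        (fderiv ℝ (coordChange x x₀) y).toLinearMap).toLinearMap := by
    filter_upwards [eventually_mem_extChartAt_target hx,
      eventually_extChartAt_symm hx (eventually_mem_extChartAt_source h₀)] with y hy hy₀
    rw [θ.inChart_eq_localRep hy, coordChange, θ.inChart_extChartAt hy₀,
      θ.localRep_coordChange ((extChartAt (𝓡 n) x).map_target hy) hy₀,
      (extChartAt (𝓡 n) x).right_inv hy]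
  rw [extDer, extDerivFlat_congr inChart_eq_pullback, extDerivFlat_pullback
    (by rw [coordChange_extChartAt hx]; exact hθ.weaklySmoothAt_inChart h₀)
    (contDiffAt_coordChange hx h₀), coordChange_extChartAt hx]
  simp only [LinearMap.comp_apply, AlgHom.toLinearMap_apply]
  rw [map_fderiv_coordChange hx h₀]

theorem FormField.IsSmooth.extDer {θ : FormField n M} (hθ : θ.IsSmooth) :
    (extDer θ).IsSmooth := by
  refine isSmooth_iff.2 fun x₀ x hx => ?_
  have hd : WeaklySmoothAt (𝓡 n) (extDerivFlat (θ.inChart x₀)) (extChartAt (𝓡 n) x₀ x) := by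
    refine WeaklySmoothAt.extDerivFlat ?_
    filter_upwards [eventually_mem_extChartAt_target hx] with y hy
    rw [← (extChartAt (𝓡 n) x₀).right_inv hy]
    exact hθ.weaklySmoothAt_inChart ((extChartAt (𝓡 n) x₀).map_target hy)
  refine (hd.comp (contMDiffAt_extChartAt_of_mem_source hx)).congr_of_eventuallyEq ?_
  filter_upwards [eventually_mem_extChartAt_source hx] with z hz
  refine LinearMap.ext fun v => ?_
  rw [← map_chartDiff_map_chartInv hz v, localRep_map_chartDiff _ hz, extDer_apply hθ hz]

theorem extDer_add {θ η : FormField n M} (hθ : θ.IsSmooth) (hη : η.IsSmooth) (x : M)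
    (v : ExteriorAlgebra ℝ (TangentSpace (𝓡 n) x)) :
    extDer (θ + η) x v = extDer θ x v + extDer η x v :=
  have hx := mem_extChartAt_source (I := 𝓡 n) x
  extDerivFlat_add (hθ.weaklySmoothAt_inChart hx) (hη.weaklySmoothAt_inChart hx) _

theorem contDiffAt_comp_extChartAt_symm {f : M → ℝ} {x₀ x : M}
    (hf : ContMDiffAt (𝓡 n) 𝓘(ℝ, ℝ) ∞ f x) (hx : x ∈ (extChartAt (𝓡 n) x₀).source) :
    ContDiffAt ℝ ∞ (fun y => f ((extChartAt (𝓡 n) x₀).symm y)) (extChartAt (𝓡 n) x₀ x) :=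
  (weaklySmoothAt_iff_contMDiffAt.1 (weaklySmoothAt_comp_extChartAt_symm hx
    (weaklySmoothAt_iff_contMDiffAt.2 hf))).contDiffAt

theorem fderiv_comp_extChartAt_symm_comp {f : M → ℝ} {x₀ x : M}
    (hf : ContMDiffAt (𝓡 n) 𝓘(ℝ, ℝ) ∞ f x) (hx : x ∈ (extChartAt (𝓡 n) x₀).source) :
    (fderiv ℝ (fun y => f ((extChartAt (𝓡 n) x₀).symm y)) (extChartAt (𝓡 n) x₀ x)).toLinearMap ∘ₗ
      chartDiff x₀ x = differential n f x := by
  have h : f =ᶠ[𝓝 x] (fun y => f ((extChartAt (𝓡 n) x₀).symm y)) ∘ extChartAt (𝓡 n) x₀ := by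
    filter_upwards [eventually_mem_extChartAt_source hx] with z hz
    exact congrArg f ((extChartAt (𝓡 n) x₀).left_inv hz).symm
  rw [differential, h.mfderiv_eq, mfderiv_comp x
    ((contDiffAt_comp_extChartAt_symm hf hx).differentiableAt (by simp)).mdifferentiableAt
    ((contMDiffAt_extChartAt_of_mem_source hx).mdifferentiableAt (by simp)), mfderiv_eq_fderiv]
  rfl

theorem extDer_smul {f : M → ℝ} (hf : IsSmoothFun n f) {θ : FormField n M} (hθ : θ.IsSmooth) (x : M)
    (v : ExteriorAlgebra ℝ (TangentSpace (𝓡 n) x)) :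
    extDer (f • θ) x v = f x * extDer θ x v + θ x (contractLeft (differential n f x) v) := by
  have hx := mem_extChartAt_source (I := 𝓡 n) x
  change extDerivFlat (fun y => f ((extChartAt (𝓡 n) x).symm y) • θ.inChart x y)
    (extChartAt (𝓡 n) x x) (ExteriorAlgebra.map (chartDiff x x) v) = _
  rw [extDerivFlat_smul (contDiffAt_comp_extChartAt_symm (hf x) hx) (hθ.weaklySmoothAt_inChart hx),
    (extChartAt (𝓡 n) x).left_inv hx, ← extDer_apply hθ hx, ← map_contractLeft,
    fderiv_comp_extChartAt_symm_comp (hf x) hx, θ.inChart_extChartAt hx,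
    θ.localRep_map_chartDiff hx]

/-! ### The bracket with a function -/

theorem schouten_ofFun (k : ℤ) (X : MultivectorField n M) {f : M → ℝ} {x : M}
    (hf : ContMDiffAt (𝓡 n) 𝓘(ℝ, ℝ) ∞ f x) :
    schouten k 0 X (ofFun n f) x = contractRight (X x) (differential n f x) := by
  have hx := mem_extChartAt_source (I := 𝓡 n) x
  have inChart_ofFun : (ofFun n f).inChart x =
      fun y => algebraMap ℝ _ (f ((extChartAt (𝓡 n) x).symm y)) :=
    funext fun y => AlgHom.commutes _ _
  have partialDeriv_ofFun (i : Fin n) := partialDeriv_algebraMap i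
    ((contDiffAt_comp_extChartAt_symm hf hx).differentiableAt (by simp))
  have contractCoord_ofFun (i : Fin n) (r : ℝ) : contractCoord i (algebraMap ℝ _ r) = 0 :=
    CliffordAlgebra.contractRight_algebraMap _ _ r
  have differential_eq := fderiv_comp_extChartAt_symm_comp hf hx
  set d := fderiv ℝ (fun y => f ((extChartAt (𝓡 n) x).symm y)) (extChartAt (𝓡 n) x x)
  have sum_coord : ∑ i, d (EuclideanSpace.single i 1) •
      (EuclideanSpace.basisFun (Fin n) ℝ).toBasis.coord i = d.toLinearMap := by
    rw [← (EuclideanSpace.basisFun (Fin n) ℝ).toBasis.sum_dual_apply_smul_coord d.toLinearMap]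
    simp
  have inChart_eq : X.inChart x (extChartAt (𝓡 n) x x) = X.localRep x x :=
    congrArg (X.localRep x) ((extChartAt (𝓡 n) x).left_inv hx)
  simp only [schouten, inChart_ofFun, partialDeriv_ofFun, contractCoord_ofFun, zero_mul, smul_zero,
    sub_zero]
  rw [← map_chartInv_map_chartDiff hx (contractRight (X x) (differential n f x)), ← differential_eq,
    map_contractRight, ← sum_coord, map_sum, inChart_eq]
  simp only [contractCoord, map_smul, Algebra.algebraMap_eq_smul_one, mul_smul_comm, mul_one]
  rfl

end Operations

/-! ### Homogeneous fields and forms -/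

section Homogeneous

variable {n : ℕ} {M : Type*} [TopologicalSpace M] [ChartedSpace (EuclideanSpace ℝ (Fin n)) M]
  [IsManifold (𝓡 n) ∞ M]

namespace MultivectorField

variable {m p q : ℤ} {X Y : MultivectorField n M} {f : M → ℝ}

theorem isKVector_zero : (0 : MultivectorField n M).IsKVector m :=
  ⟨isSmooth_zero, fun _ => zero_mem _⟩

theorem IsKVector.add (hX : X.IsKVector m) (hY : Y.IsKVector m) : (X + Y).IsKVector m :=
  ⟨hX.1.add hY.1, fun x => add_mem (hX.2 x) (hY.2 x)⟩

theorem IsKVector.smul (hf : IsSmoothFun n f) (hX : X.IsKVector m) : (f • X).IsKVector m :=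
  ⟨.smul hf hX.1, fun x => Submodule.smul_mem _ _ (hX.2 x)⟩

theorem IsKVector.mul (hX : X.IsKVector p) (hY : Y.IsKVector q) : (X * Y).IsKVector (p + q) :=
  ⟨hX.1.mul hY.1, fun x => mul_mem_extPow (hX.2 x) (hY.2 x)⟩

theorem isKVector_sum {ι : Type*} {t : Finset ι} {X : ι → MultivectorField n M}
    (hX : ∀ i ∈ t, (X i).IsKVector m) : (∑ i ∈ t, X i).IsKVector m :=
  Finset.sum_induction X (IsKVector m) (fun _ _ => IsKVector.add) isKVector_zero hX

theorem isKVector_ofFun (hf : IsSmoothFun n f) :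
    (ofFun n f : MultivectorField n M).IsKVector 0 := by
  refine ⟨isSmooth_iff.2 fun x₀ x _ => ?_, fun x => ?_⟩
  · have h : (ofFun n f).localRep x₀ = fun z => f z • 1 := funext fun z =>
      (AlgHom.commutes _ (f z)).trans (Algebra.algebraMap_eq_smul_one (f z))
    rw [h]
    exact .smul (hf x) (weaklySmoothAt_const 1 x)
  · rw [ofFun, Algebra.algebraMap_eq_smul_one]
    exact Submodule.smul_mem _ _ one_mem_extPow_zero

end MultivectorField

namespace FormField

variable {j l : ℤ} {θ η : FormField n M} {f : M → ℝ}

theorem isForm_zero : (0 : FormField n M).IsForm l :=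
  ⟨isSmooth_iff.2 fun _ x _ => weaklySmoothAt_const 0 x, fun _ _ _ _ _ => rfl⟩

theorem IsForm.add (hθ : θ.IsForm l) (hη : η.IsForm l) : (θ + η).IsForm l :=
  ⟨hθ.1.add hη.1, fun x m hm v hv => by
    rw [Pi.add_apply, LinearMap.add_apply, hθ.2 x m hm v hv, hη.2 x m hm v hv, add_zero]⟩

theorem IsForm.smul (hf : IsSmoothFun n f) (hθ : θ.IsForm l) : (f • θ).IsForm l :=
  ⟨.smul hf hθ.1, fun x m hm v hv => by
    rw [Pi.smul_apply', LinearMap.smul_apply, hθ.2 x m hm v hv, smul_zero]⟩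

theorem IsForm.interior {X : MultivectorField n M} (hX : X.IsKVector j) (hθ : θ.IsForm l) :
    (HigherAffine.interior X θ).IsForm (l - j) :=
  ⟨.interior hX.1 hθ.1, fun x m hm _ hv =>
    hθ.2 x (j + m) (by lia) _ (mul_mem_extPow (hX.2 x) hv)⟩

end FormField

end Homogeneous

/-! ### Local frames -/

section Frames

variable {n : ℕ} {M : Type*} [TopologicalSpace M] [ChartedSpace (EuclideanSpace ℝ (Fin n)) M]

/-- A smooth bump function around `x₀`, which extends objects given in the chart around `x₀` to all
of `M`. -/
noncomputable def bump (n : ℕ) {M : Type*} [TopologicalSpace M]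
    [ChartedSpace (EuclideanSpace ℝ (Fin n)) M] (x₀ : M) : SmoothBumpFunction (𝓡 n) x₀ :=
  Classical.arbitrary _

/-- The coordinate multivector field `∂_s` of the chart around `x₀`, cut off by a bump function. -/
noncomputable def frameField (x₀ : M) (s : Finset (Fin n)) : MultivectorField n M := fun x =>
  bump n x₀ x • ExteriorAlgebra.map (chartInv x₀ x) (wedgeBasis n s)

/-- The components of a multivector field in the chart around `x₀`, cut off by a bump function. -/
noncomputable def cutoffCoord (Y : MultivectorField n M) (x₀ : M) (s : Finset (Fin n)) (x : M) :
    ℝ :=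
  bump n x₀ x * (wedgeBasis n).repr (Y.localRep x₀ x) s

theorem frameField_self (x : M) (s : Finset (Fin n)) :
    frameField x s x = ExteriorAlgebra.map (chartInv x x) (wedgeBasis n s) := by
  rw [frameField, (bump n x).eq_one, one_smul]

theorem mem_source_of_mem_tsupport_bump [T2Space M] {x₀ x : M} (hx : x ∈ tsupport (bump n x₀)) :
    x ∈ (extChartAt (𝓡 n) x₀).source :=
  (bump n x₀).tsupport_subset_extChartAt_source hx

variable [IsManifold (𝓡 n) ∞ M]

theorem localRep_frameField {x₀ x : M} (s : Finset (Fin n))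
    (hx : x ∈ (extChartAt (𝓡 n) x₀).source) :
    (frameField x₀ s).localRep x₀ x = bump n x₀ x • wedgeBasis n s := by
  rw [MultivectorField.localRep, frameField, map_smul, map_chartDiff_map_chartInv hx]

variable [T2Space M]

theorem isSmoothFun_bump (x₀ : M) : IsSmoothFun n (bump n x₀) :=
  (bump n x₀).contMDiff

theorem isKVector_frameField (x₀ : M) (s : Finset (Fin n)) :
    (frameField x₀ s).IsKVector s.card := by
  refine ⟨MultivectorField.isSmooth_of_weaklySmoothAt fun x => ?_, fun x =>
    Submodule.smul_mem _ _ (map_mem_extPow _ (wedgeBasis_mem_extPow s))⟩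
  by_cases hx : x ∈ (extChartAt (𝓡 n) x₀).source
  · refine ⟨x₀, hx, (WeaklySmoothAt.smul (isSmoothFun_bump x₀ x)
      (weaklySmoothAt_const (wedgeBasis n s) x)).congr_of_eventuallyEq ?_⟩
    filter_upwards [eventually_mem_extChartAt_source hx] with z hz using localRep_frameField s hz
  · refine ⟨x, mem_extChartAt_source x, (weaklySmoothAt_const 0 x).congr_of_eventuallyEq ?_⟩
    filter_upwards [notMem_tsupport_iff_eventuallyEq.1 (mt mem_source_of_mem_tsupport_bump hx)]
      with z hz
    rw [MultivectorField.localRep, frameField, hz, Pi.zero_apply, zero_smul, map_zero]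

theorem isSmoothFun_cutoffCoord {Y : MultivectorField n M} (hY : Y.IsSmooth) (x₀ : M)
    (s : Finset (Fin n)) : IsSmoothFun n (cutoffCoord Y x₀ s) :=
  contMDiff_of_tsupport fun x hx => (isSmoothFun_bump x₀ x).mul <|
    (weaklySmoothAt_iff_repr (wedgeBasis n)).1 (MultivectorField.isSmooth_iff.1 hY x₀ x
      (mem_source_of_mem_tsupport_bump (tsupport_mul_subset_left hx))) s

theorem bump_mul_bump_smul_eq_sum {m : ℤ} {Y : MultivectorField n M} (hY : Y.IsKVector m) (x₀ : M) :
    (bump n x₀ * bump n x₀ : M → ℝ) • Y =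
      ∑ s with (s.card : ℤ) = m, cutoffCoord Y x₀ s • frameField x₀ s := by
  funext x
  rw [Finset.sum_apply]
  simp only [Pi.smul_apply', Pi.mul_apply]
  by_cases hx : x ∈ (extChartAt (𝓡 n) x₀).source
  · have repr_eq_zero (s : Finset (Fin n)) (hs : (s.card : ℤ) ≠ m) :
        (wedgeBasis n).repr (Y.localRep x₀ x) s = 0 :=
      wedgeBasis_repr_eq_zero (map_mem_extPow _ (hY.2 x)) hs
    have sum_frame : ∑ s with (s.card : ℤ) = m, (wedgeBasis n).repr (Y.localRep x₀ x) s •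
        ExteriorAlgebra.map (chartInv x₀ x) (wedgeBasis n s) = Y x := by
      conv_rhs => rw [← map_chartInv_map_chartDiff hx (Y x), ← MultivectorField.localRep,
        ← (wedgeBasis n).sum_repr (Y.localRep x₀ x), map_sum]
      simp only [map_smul]
      exact Finset.sum_subset (Finset.subset_univ _) fun s _ hs => by
        rw [repr_eq_zero s (by simpa using hs), zero_smul]
    conv_lhs => rw [← sum_frame, Finset.smul_sum]
    refine Finset.sum_congr rfl fun s _ => ?_
    rw [cutoffCoord, frameField, smul_smul, smul_smul, mul_right_comm]
  · have bump_eq_zero : bump n x₀ x = 0 :=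
      image_eq_zero_of_notMem_tsupport (mt mem_source_of_mem_tsupport_bump hx)
    simp [frameField, bump_eq_zero]

theorem FormField.IsForm.ext {m : ℤ} {η η' : FormField n M} (h : η.IsForm m) (h' : η'.IsForm m)
    (heq : ∀ Y : MultivectorField n M, Y.IsKVector m → ∀ x, η x (Y x) = η' x (Y x)) : η = η' := by
  funext x
  have localRep_eq : η.localRep x x = η'.localRep x x := by
    refine (wedgeBasis n).ext fun s => ?_
    change η x (ExteriorAlgebra.map (chartInv x x) _) = η' x (ExteriorAlgebra.map (chartInv x x) _)
    by_cases hs : (s.card : ℤ) = m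
    · rw [← frameField_self]
      exact heq _ (hs ▸ isKVector_frameField x s) x
    · have hmem := map_mem_extPow (chartInv x x) (wedgeBasis_mem_extPow s)
      rw [h.2 x _ hs _ hmem, h'.2 x _ hs _ hmem]
  refine LinearMap.ext fun v => ?_
  have hx := mem_extChartAt_source (I := 𝓡 n) x
  rw [← η.localRep_map_chartDiff hx, localRep_eq, η'.localRep_map_chartDiff hx]

end Frames

/-! ### Tensorial maps -/

section Tensorial

variable {n : ℕ} {M : Type*} [TopologicalSpace M] [ChartedSpace (EuclideanSpace ℝ (Fin n)) M]

/-- `Φ` restricts to a `C^∞(M)`-linear map `A^m(M) → C^∞(M)`. Such maps are the `m`-forms; nothing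
is required of `Φ` on other multivector fields. -/
structure IsTensorial (m : ℤ) (Φ : MultivectorField n M → M → ℝ) : Prop where
  isSmoothFun : ∀ {Y}, Y.IsKVector m → IsSmoothFun n (Φ Y)
  map_add : ∀ {Y Z}, Y.IsKVector m → Z.IsKVector m → Φ (Y + Z) = Φ Y + Φ Z
  map_smul : ∀ {f : M → ℝ} {Y}, IsSmoothFun n f → Y.IsKVector m → Φ (f • Y) = f * Φ Y

/-- The form of degree `m` that takes the values `Φ (∂_s)` on the coordinate `m`-vector fields
`∂_s`; at `x` these are the ones of the preferred chart at `x`. -/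
noncomputable def formOfValues (m : ℤ) (Φ : MultivectorField n M → M → ℝ) :
    FormField n M := fun x =>
  ∑ s with (s.card : ℤ) = m, Φ (frameField x s) x •
    ((wedgeBasis n).coord s ∘ₗ (ExteriorAlgebra.map (chartDiff x x)).toLinearMap)

variable {m : ℤ} {Φ : MultivectorField n M → M → ℝ}

theorem formOfValues_apply (x : M) (v : ExteriorAlgebra ℝ (TangentSpace (𝓡 n) x)) :
    formOfValues m Φ x v = ∑ s with (s.card : ℤ) = m, Φ (frameField x s) x *
      (wedgeBasis n).repr (ExteriorAlgebra.map (chartDiff x x) v) s := by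
  rw [formOfValues, LinearMap.sum_apply]
  rfl

theorem formOfValues_apply_eq_zero {x : M} {p : ℤ} (hp : p ≠ m)
    {v : ExteriorAlgebra ℝ (TangentSpace (𝓡 n) x)} (hv : v ∈ extPow (TangentSpace (𝓡 n) x) p) :
    formOfValues m Φ x v = 0 := by
  rw [formOfValues_apply]
  refine Finset.sum_eq_zero fun s hs => ?_
  rw [wedgeBasis_repr_eq_zero (map_mem_extPow _ hv) ((Finset.mem_filter.1 hs).2.trans_ne hp.symm),
    mul_zero]

variable [IsManifold (𝓡 n) ∞ M]

namespace IsTensorial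

theorem map_zero (hΦ : IsTensorial m Φ) : Φ 0 = 0 := by
  simpa using hΦ.map_add MultivectorField.isKVector_zero MultivectorField.isKVector_zero

theorem map_sum (hΦ : IsTensorial m Φ) {ι : Type*} {t : Finset ι} {Y : ι → MultivectorField n M}
    (hY : ∀ i ∈ t, (Y i).IsKVector m) : Φ (∑ i ∈ t, Y i) = ∑ i ∈ t, Φ (Y i) := by
  classical
  induction t using Finset.induction_on with
  | empty => simpa using hΦ.map_zero
  | insert i t hi ih =>
    have ht := fun j hj => hY j (Finset.mem_insert_of_mem hj)
    rw [Finset.sum_insert hi, Finset.sum_insert hi, hΦ.map_add (hY i (Finset.mem_insert_self i t))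
      (MultivectorField.isKVector_sum ht), ih ht]

variable [T2Space M]

theorem formOfValues_apply (hΦ : IsTensorial m Φ) {Y : MultivectorField n M} (hY : Y.IsKVector m)
    (x : M) : formOfValues m Φ x (Y x) = Φ Y x := by
  have hF {s : Finset (Fin n)} (hs : s ∈ ({s | (s.card : ℤ) = m} : Finset (Finset (Fin n)))) :
      (frameField x s).IsKVector m :=
    (Finset.mem_filter.1 hs).2 ▸ isKVector_frameField x s
  have hcoord (s : Finset (Fin n)) := isSmoothFun_cutoffCoord hY.1 x s
  calc formOfValues m Φ x (Y x)
      = ∑ s with (s.card : ℤ) = m, Φ (cutoffCoord Y x s • frameField x s) x := by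
        rw [HigherAffine.formOfValues_apply]
        refine Finset.sum_congr rfl fun s hs => ?_
        rw [hΦ.map_smul (hcoord s) (hF hs), Pi.mul_apply, cutoffCoord, (bump n x).eq_one, one_mul,
          mul_comm]
        rfl
    _ = Φ ((bump n x * bump n x : M → ℝ) • Y) x := by
        rw [bump_mul_bump_smul_eq_sum hY, hΦ.map_sum fun s hs => .smul (hcoord s) (hF hs),
          Finset.sum_apply]
    _ = Φ Y x := by
        rw [hΦ.map_smul (ContMDiff.mul (isSmoothFun_bump x) (isSmoothFun_bump x)) hY]
        simp

theorem isForm_formOfValues (hΦ : IsTensorial m Φ) : (formOfValues m Φ).IsForm m := by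
  refine ⟨FormField.isSmooth_of_weaklySmoothAt fun x => ⟨x, mem_extChartAt_source x,
    (weaklySmoothAt_dual_iff_basis (wedgeBasis n)).2 fun s => ?_⟩,
    fun x p hp v hv => formOfValues_apply_eq_zero hp hv⟩
  by_cases hs : (s.card : ℤ) = m
  · have hF : (frameField x s).IsKVector m := hs ▸ isKVector_frameField x s
    refine (hΦ.isSmoothFun hF x).congr_of_eventuallyEq ?_
    filter_upwards [eventually_mem_extChartAt_source (mem_extChartAt_source (I := 𝓡 n) x),
      (bump n x).eventuallyEq_one] with z hz hbump
    rw [← hΦ.formOfValues_apply hF, ← FormField.localRep_apply_localRep _ _ hz,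
      localRep_frameField s hz, hbump, Pi.one_apply, one_smul]
  · refine contMDiffAt_const (c := (0 : ℝ)) |>.congr_of_eventuallyEq (.of_forall fun z => ?_)
    exact formOfValues_apply_eq_zero hs (map_mem_extPow _ (wedgeBasis_mem_extPow s))

theorem existsUnique_isForm (hΦ : IsTensorial m Φ) : ∃! η : FormField n M,
    η.IsForm m ∧ ∀ Y : MultivectorField n M, Y.IsKVector m → ∀ x, η x (Y x) = Φ Y x :=
  ⟨formOfValues m Φ, ⟨hΦ.isForm_formOfValues, fun _ hY => hΦ.formOfValues_apply hY⟩,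
    fun _ hη => hη.1.ext hΦ.isForm_formOfValues fun Y hY x =>
      (hη.2 Y hY x).trans (hΦ.formOfValues_apply hY x).symm⟩

end IsTensorial

end Tensorial

/-! ### The covariant derivative of forms -/

section LieDerivative

variable {n : ℕ} {M : Type*} [TopologicalSpace M] [ChartedSpace (EuclideanSpace ℝ (Fin n)) M]

theorem interior_add (Y Y' : MultivectorField n M) (θ : FormField n M) :
    interior (Y + Y') θ = interior Y θ + interior Y' θ :=
  funext fun x => LinearMap.ext fun v =>
    (congrArg (θ x) (add_mul (Y x) (Y' x) v)).trans (map_add _ _ _)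

theorem interior_smul (f : M → ℝ) (Y : MultivectorField n M) (θ : FormField n M) :
    interior (f • Y) θ = f • interior Y θ :=
  funext fun x => LinearMap.ext fun v =>
    (congrArg (θ x) (smul_mul_assoc (f x) (Y x) v)).trans (map_smul _ _ _)

theorem interior_interior (Y W : MultivectorField n M) (θ : FormField n M) :
    interior Y (interior W θ) = interior (W * Y) θ :=
  funext fun x => LinearMap.ext fun v => congrArg (θ x) (mul_assoc (W x) (Y x) v).symm

theorem lieDer_apply_one (k : ℤ) (X : MultivectorField n M) (θ : FormField n M) (x : M) :
    lieDer k X θ x 1 = -((-1 : ℝ) ^ k * extDer θ x (X x)) := by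
  change extDer (interior X θ) x 1 - (-1 : ℝ) ^ k * extDer θ x (X x * 1) = _
  rw [extDer_apply_one, mul_one, zero_sub]

variable [IsManifold (𝓡 n) ∞ M]

theorem neg_one_zpow_mul_lieDer_smul_interior {k l : ℤ} {X Y : MultivectorField n M}
    (hX : X.IsKVector k) (hY : Y.IsKVector (l - k + 1)) {θ : FormField n M} (hθ : θ.IsSmooth)
    {f : M → ℝ} (hf : IsSmoothFun n f) (x : M) :
    (-1 : ℝ) ^ ((k - 1) * (l - 1)) * lieDer k X (f • interior Y θ) x 1 =
      f x * ((-1 : ℝ) ^ ((k - 1) * (l - 1)) * lieDer k X (interior Y θ) x 1) +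
        θ x (schouten k 0 X (ofFun n f) x * Y x) := by
  have leibniz_defect : interior Y θ x (contractLeft (differential n f x) (X x)) =
      (-1 : ℝ) ^ ((k - 1) * (l - k + 1 + 1)) * θ x (schouten k 0 X (ofFun n f) x * Y x) := by
    rw [schouten_ofFun k X (hf x), ← smul_eq_mul, ← map_smul,
      ← mul_contractLeft_of_mem_extPow _ (hX.2 x) (hY.2 x)]
    rfl
  have sign : (-1 : ℝ) ^ ((k - 1) * (l - 1)) * (-1) ^ k * (-1) ^ ((k - 1) * (l - k + 1 + 1)) =
      -1 := by
    rw [← zpow_add₀ (by norm_num), ← zpow_add₀ (by norm_num)]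
    obtain ⟨r, hr⟩ := Int.even_mul_succ_self (k - 1)
    exact Odd.neg_one_zpow ⟨(k - 1) * l + k - 1 - r, by linear_combination -hr⟩
  rw [lieDer_apply_one, lieDer_apply_one, extDer_smul hf (.interior hY.1 hθ), leibniz_defect]
  linear_combination -θ x (schouten k 0 X (ofFun n f) x * Y x) * sign

end LieDerivative

namespace HigherConnection

variable {n : ℕ} {M : Type*} [TopologicalSpace M] [ChartedSpace (EuclideanSpace ℝ (Fin n)) M]
  {C : HigherConnection n M} {k l : ℤ} {X Y : MultivectorField n M} {θ η η' : FormField n M}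
  {f : M → ℝ}

/-- The value on `Y ∈ A^(l-k+1)(M)` that `IsCovDer` prescribes for the covariant derivative of
`θ ∈ Ω^l(M)` along `X ∈ A^k(M)`. -/
noncomputable def covDerValue (C : HigherConnection n M) (k l : ℤ) (X : MultivectorField n M)
    (θ : FormField n M) (Y : MultivectorField n M) (x : M) : ℝ :=
  (-1 : ℝ) ^ ((k - 1) * (l - 1)) * lieDer k X (interior Y θ) x 1 - θ x (C.D X Y x)

variable [IsManifold (𝓡 n) ∞ M]

theorem D_smul_left (hX : X.IsSmooth) (hY : Y.IsSmooth) (hf : IsSmoothFun n f) :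
    C.D (f • X) Y = f • C.D X Y := by
  have D_zero_left : C.D 0 Y = 0 := by
    simpa using C.linear_left 1 0 0 Y contMDiff_const MultivectorField.isSmooth_zero
      MultivectorField.isSmooth_zero hY
  simpa [D_zero_left] using C.linear_left f X 0 Y hf hX MultivectorField.isSmooth_zero hY

theorem isKVector_schouten_ofFun (C : HigherConnection n M) (hX : X.IsKVector k)
    (hf : IsSmoothFun n f) : (schouten k 0 X (ofFun n f)).IsKVector (k - 1) := by
  rw [← C.apply_fun k X f hX hf]
  simpa using C.degree k 0 X _ hX (MultivectorField.isKVector_ofFun hf)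

theorem isTensorial_covDerValue (C : HigherConnection n M) (hX : X.IsKVector k) (hθ : θ.IsSmooth) :
    IsTensorial (l - k + 1) (C.covDerValue k l X θ) where
  isSmoothFun {Y} hY := by
    unfold covDerValue
    simp only [lieDer_apply_one]
    exact (contMDiff_const.mul (contMDiff_const.mul
      ((hθ.interior hY.1).extDer.isSmoothFun_apply hX.1)).neg).sub
      (hθ.isSmoothFun_apply (C.smooth X Y hX.1 hY.1))
  map_add {Y Z} hY hZ := by
    funext x
    simp only [covDerValue, lieDer_apply_one, Pi.add_apply]
    rw [interior_add, extDer_add (hθ.interior hY.1) (hθ.interior hZ.1),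
      C.add_right X Y Z hX.1 hY.1 hZ.1, Pi.add_apply, map_add]
    ring
  map_smul {f Y} hf hY := by
    funext x
    have apply_D_smul : θ x (C.D X (f • Y) x) =
        θ x (schouten k 0 X (ofFun n f) x * Y x) + f x * θ x (C.D X Y x) := by
      rw [C.leibniz k X Y f hX hf hY.1, Pi.add_apply, map_add, Pi.mul_apply, Pi.smul_apply',
        map_smul, smul_eq_mul]
    rw [Pi.mul_apply, covDerValue, covDerValue, interior_smul,
      neg_one_zpow_mul_lieDer_smul_interior hX hY hθ hf, apply_D_smul]
    ring

namespace IsCovDer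

theorem smul_left (h : C.IsCovDer k l X θ η) (hX : X.IsSmooth) (hf : IsSmoothFun n f) :
    C.IsCovDer k l (f • X) θ (f • η) := by
  refine ⟨h.1.smul hf, fun Y hY x => ?_⟩
  rw [Pi.smul_apply', LinearMap.smul_apply, h.2 Y hY x, D_smul_left hX hY.1 hf, lieDer_apply_one,
    lieDer_apply_one, Pi.smul_apply', Pi.smul_apply', map_smul, map_smul, smul_eq_mul, smul_eq_mul,
    smul_eq_mul]
  ring

theorem smul_right (h : C.IsCovDer k l X θ η) (hX : X.IsKVector k) (hθ : θ.IsForm l)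
    (hf : IsSmoothFun n f) :
    C.IsCovDer k l X (f • θ) (f • η + interior (schouten k 0 X (ofFun n f)) θ) := by
  have isForm_interior : (interior (schouten k 0 X (ofFun n f)) θ).IsForm (l - k + 1) := by
    convert hθ.interior (C.isKVector_schouten_ofFun hX hf) using 1
    ring
  refine ⟨(h.1.smul hf).add isForm_interior, fun Y hY x => ?_⟩
  change f x * η x (Y x) + θ x (schouten k 0 X (ofFun n f) x * Y x) =
    (-1 : ℝ) ^ ((k - 1) * (l - 1)) * lieDer k X (f • interior Y θ) x 1 - f x * θ x (C.D X Y x)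
  rw [h.2 Y hY x, neg_one_zpow_mul_lieDer_smul_interior hX hY hθ.1 hf]
  ring

theorem interior (h : C.IsCovDer k l X θ η) (hC : C.IsUpperInduced) (hX : X.IsKVector k)
    (hθ : θ.IsForm l) {j : ℤ} {W : MultivectorField n M} (hW : W.IsKVector j) :
    C.IsCovDer k (l - j) X (HigherAffine.interior W θ) ((-1 : ℝ) ^ (j * (k - 1)) •
      (HigherAffine.interior W η + HigherAffine.interior (C.D X W) θ)) := by
  have isForm_left : (HigherAffine.interior W η).IsForm (l - j - k + 1) := by
    convert h.1.interior hW using 1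
    ring
  have isForm_right : (HigherAffine.interior (C.D X W) θ).IsForm (l - j - k + 1) := by
    convert hθ.interior (C.degree k j X W hX hW) using 1
    ring
  refine ⟨.smul contMDiff_const (isForm_left.add isForm_right), fun Y hY x => ?_⟩
  have hWY : (W * Y).IsKVector (l - k + 1) := by
    convert hW.mul hY using 1
    ring
  have apply_D_mul : θ x (C.D X (W * Y) x) = θ x (C.D X W x * Y x) +
      (-1 : ℝ) ^ ((k - 1) * j) * θ x (W x * C.D X Y x) := by
    rw [hC k j X W Y hX hW hY.1, Pi.add_apply, map_add, Pi.mul_apply, Pi.smul_apply, map_smul,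
      Pi.mul_apply, smul_eq_mul]
  have sign_sq : (-1 : ℝ) ^ (j * (k - 1)) * (-1) ^ ((k - 1) * j) = 1 := by
    rw [← zpow_add₀ (by norm_num)]
    exact Even.neg_one_zpow ⟨j * (k - 1), by ring⟩
  have sign_shift : (-1 : ℝ) ^ ((k - 1) * (l - j - 1)) * (-1) ^ ((k - 1) * j) =
      (-1) ^ ((k - 1) * (l - 1)) := by
    rw [← zpow_add₀ (by norm_num)]
    congr 1
    ring
  change (-1 : ℝ) ^ (j * (k - 1)) * (η x ((W * Y) x) + θ x (C.D X W x * Y x)) =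
    (-1 : ℝ) ^ ((k - 1) * (l - j - 1)) * lieDer k X (HigherAffine.interior Y
      (HigherAffine.interior W θ)) x 1 - θ x (W x * C.D X Y x)
  rw [h.2 _ hWY x, apply_D_mul, interior_interior, ← sign_shift]
  linear_combination ((-1 : ℝ) ^ ((k - 1) * (l - j - 1)) * lieDer k X
    (HigherAffine.interior (W * Y) θ) x 1 - θ x (W x * C.D X Y x)) * sign_sq

end IsCovDer

variable [T2Space M]

theorem existsUnique_isCovDer (C : HigherConnection n M) (hX : X.IsKVector k) (hθ : θ.IsSmooth) :
    ∃! η, C.IsCovDer k l X θ η :=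
  (C.isTensorial_covDerValue hX hθ).existsUnique_isForm

theorem IsCovDer.unique (h : C.IsCovDer k l X θ η) (h' : C.IsCovDer k l X θ η') : η = η' :=
  h.1.ext h'.1 fun Y hY x => (h.2 Y hY x).trans (h'.2 Y hY x).symm

theorem isCovDer_covDer (C : HigherConnection n M) (hk : 0 < k) (hX : X.IsKVector k)
    (hθ : θ.IsSmooth) : C.IsCovDer k l X θ (C.covDer k l X θ) := by
  obtain ⟨η, hη, -⟩ := C.existsUnique_isCovDer (l := l) hX hθ
  rcases lt_or_ge (l - k + 1) 0 with hneg | hnonneg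
  · have covDer_eq_zero : C.covDer k l X θ = 0 := dif_neg fun h => hneg.not_ge h.2.1
    have eq_zero : η = 0 := hη.1.ext FormField.isForm_zero fun Y hY x => by
      rw [eq_zero_of_mem_extPow_of_neg hneg (hY.2 x), map_zero, map_zero]
    rwa [covDer_eq_zero, ← eq_zero]
  · have h : 0 < k ∧ 0 ≤ l - k + 1 ∧ ∃ η, C.IsCovDer k l X θ η := ⟨hk, hnonneg, η, hη⟩
    rw [covDer, dif_pos h]
    exact h.2.2.choose_spec

end HigherConnection

theorem mainTheorem7_general (n : ℕ) (M : Type*) [TopologicalSpace M] [T2Space M]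
    [ChartedSpace (EuclideanSpace ℝ (Fin n)) M] [IsManifold (𝓡 n) ∞ M]
    (C : HigherConnection n M) (k l : ℤ) (hk : 0 < k)
    (X : MultivectorField n M) (hX : X.IsKVector k)
    (θ : FormField n M) (hθ : θ.IsForm l) :
    ((∃! η : FormField n M, C.IsCovDer k l X θ η) ∧ C.IsCovDer k l X θ (C.covDer k l X θ)) ∧
    (∀ f : M → ℝ, IsSmoothFun n f →
      C.covDer k l (f • X) θ = f • C.covDer k l X θ) ∧
    (∀ f : M → ℝ, IsSmoothFun n f →
      C.covDer k l X (f • θ) =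
        f • C.covDer k l X θ + interior (schouten k 0 X (ofFun n f)) θ) ∧
    (C.IsUpperInduced → ∀ (j : ℤ) (W : MultivectorField n M), W.IsKVector j →
      C.covDer k (l - j) X (interior W θ) =
        ((-1 : ℝ) ^ (j * (k - 1))) •
          (interior W (C.covDer k l X θ) + interior (C.D X W) θ)) := by
  have isCovDer_θ : C.IsCovDer k l X θ (C.covDer k l X θ) := C.isCovDer_covDer hk hX hθ.1
  refine ⟨⟨C.existsUnique_isCovDer hX hθ.1, isCovDer_θ⟩, fun f hf => ?_, fun f hf => ?_,
    fun hC j W hW => ?_⟩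
  · exact (C.isCovDer_covDer hk (hX.smul hf) hθ.1).unique (isCovDer_θ.smul_left hX.1 hf)
  · exact (C.isCovDer_covDer hk hX (hθ.1.smul hf)).unique (isCovDer_θ.smul_right hX hθ hf)
  · exact (C.isCovDer_covDer hk hX (.interior hW.1 hθ.1)).unique
      (isCovDer_θ.interior hC hX hθ hW)

end HigherAffine

open HigherAffine in
theorem mainTheorem7 (n : ℕ) (M : Type*) [TopologicalSpace M] [T2Space M]
    [SecondCountableTopology M] [ChartedSpace (EuclideanSpace ℝ (Fin n)) M] [IsManifold (𝓡 n) ∞ M]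
    (C : HigherConnection n M) (k l : ℤ) (hk : 0 < k)
    (X : MultivectorField n M) (hX : X.IsKVector k)
    (θ : FormField n M) (hθ : θ.IsForm l) :
    (0 ≤ l - k + 1 → (∃! η : FormField n M, C.IsCovDer k l X θ η) ∧
      C.IsCovDer k l X θ (C.covDer k l X θ)) ∧
    (∀ f : M → ℝ, IsSmoothFun n f →
      C.covDer k l (f • X) θ = f • C.covDer k l X θ) ∧
    (∀ f : M → ℝ, IsSmoothFun n f →
      C.covDer k l X (f • θ) =
        f • C.covDer k l X θ + interior (schouten k 0 X (ofFun n f)) θ) ∧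
    (C.IsUpperInduced → ∀ (j : ℤ) (W : MultivectorField n M), W.IsKVector j →
      C.covDer k (l - j) X (interior W θ) =
        ((-1 : ℝ) ^ (j * (k - 1))) •
          (interior W (C.covDer k l X θ) + interior (C.D X W) θ)) := by
  have h := mainTheorem7_general n M C k l hk X hX θ hθ
  exact ⟨fun _ => h.1, h.2⟩
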